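/- **Setting.** Let $n\ge 1$, $d_1,\dots,d_n\ge 1$, $d=\sum_i d_i$. Player $i$ chooses $x_i$ in a closed convex set $\mathcal X_i\subseteq\mathbb R^{d_i}$ and has cost $f_i(x_i,x_{-i})$; put $\mathcal X=\prod_i\mathcal X_i$ and suppose $r\mathbb B\subseteq\mathcal X\subseteq R\mathbb B$ with $r,R>0$. The (measurable) costs are given on $\mathcal D=\prod_i\mathcal D_i$, where $\mathcal D_i\supseteq\mathcal X_i$ are closed convex sets (possibly $\mathcal D_i=\mathcal X_i$). With $\mathbb S_i$ the unit sphere of $\mathbb R^{d_i}$ and constants $\alpha>0$, $\beta,L\ge 0$, assume: * $f_i$ is convex and $C^1$ in $x_i$ on $\mathcal D$, and $\nabla_i f_i$ is $\beta$-Lipschitz on $\mathcal D$; * the Jacobian of $\nabla_i f_i$ exists and is $L$-Lipschitz on $\mathcal D$ in operator norm; * $g=(\nabla_1 f_1,\dots,\nabla_n f_n)$ is $\alpha$-strongly monotone on $\mathcal D$: $\langle g(x)-g(x'),x-x'\rangle\ge\alpha\|x-x'\|^2$; * $F_*:=\max_i\sup_{x\in\mathcal D}|f_i(x)|^2<\infty$.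 Let $x^\star$ be a Nash equilibrium of the game on $\mathcal X$. **Algorithm** $\mathtt{DFO}(x^0,\{\eta_t\},\delta,T)$. For $t=0,\dots,T-1$ and all $i$ simultaneously: sample $v_i^t$ uniformly from $\mathbb S_i$, set $\hat g_i^t=\frac{d_i}{\delta}f_i(x^t+\delta v^t)\,v_i^t$ and $x_i^{t+1}=\mathrm{proj}_{(1-\delta)\mathcal X_i}(x_i^t-\eta_t\hat g_i^t)$. The output is $x^T$. All samples (over players, iterations and runs) are independent. Here $\eta_t=\frac{2}{\alpha t}$ for $t\ge 1$ and $\eta_0$ is arbitrary. (The same conclusions hold if iteration $t=0,1,\dots$ uses the step $\frac{2}{\alpha(t+1)}$ instead.) **Restarts.** Define $$A=\frac{8F_*d^2n}{\alpha^2},\quad B=2\Big(\big(1+\tfrac{\beta\sqrt n}{\alpha}\big)R+\tfrac{\beta n}{\alpha}\Big)^2,\quad \delta_1=\min\Big\{r,\frac{\alpha}{2Ln^{3/2}}\Big\}$$ (with $\delta_1=r$ if $L=0$). Assume $\delta_1\le 1$ and that the points that may be queried lie in the domain of the costs: $(1-\delta_1)x_i+\delta_1 v_i\in\mathcal D_i$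 for all $x_i\in\mathcal X_i$, $v_i\in\mathbb S_i$ (automatic when each $\mathcal X_i$ contains the unit ball). Fix $q\in(0,1)$ and $y^0=x^0\in(1-\delta_1)\mathcal X$, and for $k\ge 1$ let $$\delta_{k+1}=q\,\delta_k,\qquad T_k=\Big\lceil\max\Big\{\frac{A}{B\delta_k^4},\frac{4R^2}{B\delta_k^2}\Big\}\Big\rceil,\qquad y^k=\mathtt{DFO}(y^{k-1},\{\eta_t\},\delta_k,T_k).$$ **Claim.** For every $k\ge 1$, with $\varepsilon_k:=2B\delta_1^2q^{2(k-1)}$, $$\mathbb E\|y^k-x^\star\|^2\le\varepsilon_k,$$ and the total number $\sum_{i=1}^kT_i$ of iterations used to generate $y^k$ is at most $$1+\frac12\log_{1/q}\Big(\frac{2B\delta_1^2}{\varepsilon_k}\Big)+\frac{4BA\,q^{-4}}{q^{-4}-1}\,\varepsilon_k^{-2}+\frac{8R^2q^{-2}}{q^{-2}-1}\,\varepsilon_k^{-1}.$$ Consequently the scheme has anytime efficiency $O(d^2/\varepsilon^2)$: for every $\varepsilon\in(0,2B\delta_1^2]$ there is $K\ge1$ such that $\mathbb E\|y^k-x^\star\|^2\le\varepsilon$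 for all $k\ge K$ and $\sum_{i=1}^KT_i\le C\,d^2/\varepsilon^2$, where $$C=q^{-4}\Big[(2B\delta_1^2)^2\Big(1+\frac{1}{4\ln(1/q)}\Big)+\frac{32BF_*n}{\alpha^2}\cdot\frac{q^{-4}}{q^{-4}-1}+16R^2B\delta_1^2\cdot\frac{q^{-2}}{q^{-2}-1}\Big].$$ In the single player case $n=1$, all of this also holds with $\delta_1=r$ (still assuming $\delta_1\le1$ and the query condition), without the assumption on the Jacobian. -/

import Mathlib

open scoped Pointwise

noncomputable section

/-- A joint strategy `x = (x₁, …, xₙ)` with `x i ∈ ℝ^{d i}`, carrying the Euclidean norm of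
`ℝ^{d₁ + ⋯ + dₙ}`. -/
abbrev Profile {n : ℕ} (d : Fin n → ℕ) : Type :=
  PiLp 2 (fun i : Fin n => EuclideanSpace ℝ (Fin (d i)))

/-- An `n`-player game: player `i` chooses a point of `X i ⊆ ℝ^{d i}` and pays `cost i x`.
The costs are regarded as functions on the product of sets `D i ⊇ X i`; the case `D = X` is that of
costs defined on the joint strategy set only. Values of `cost` outside this product are
irrelevant. -/
structure Game {n : ℕ} (d : Fin n → ℕ) where
  X : ∀ i, Set (EuclideanSpace ℝ (Fin (d i)))
  D : ∀ i, Set (EuclideanSpace ℝ (Fin (d i)))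
  cost : Fin n → Profile d → ℝ

namespace Game

variable {n : ℕ} {d : Fin n → ℕ}

/-- The profile `(z, x₋ᵢ)`. -/
def replace (x : Profile d) (i : Fin n) (z : EuclideanSpace ℝ (Fin (d i))) : Profile d :=
  WithLp.toLp 2 (Function.update (WithLp.ofLp x) i z)

/-- The joint strategy set `X₁ × ⋯ × Xₙ`. -/
def strategies (G : Game d) : Set (Profile d) := {x | ∀ i, x i ∈ G.X i}

/-- The product `D₁ × ⋯ × Dₙ`. -/
def domain (G : Game d) : Set (Profile d) := {x | ∀ i, x i ∈ G.D i}

/-- `x` is a Nash equilibrium: no player can lower their cost by a unilateral deviation. -/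
def IsNash (G : Game d) (x : Profile d) : Prop :=
  x ∈ G.strategies ∧ ∀ i, ∀ z ∈ G.X i, G.cost i x ≤ G.cost i (replace x i z)

/-- `∇ᵢ fᵢ (x)`, the gradient of `z ↦ fᵢ (z, x₋ᵢ)` at `z = xᵢ`, relative to `D i`
(one-sided at boundary points). -/
def partialGrad (G : Game d) (i : Fin n) (x : Profile d) : EuclideanSpace ℝ (Fin (d i)) :=
  gradientWithin (fun z => G.cost i (replace x i z)) (G.D i) (x i)

/-- `g(x) = (∇₁ f₁ (x), …, ∇ₙ fₙ (x))`. -/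
def gradMap (G : Game d) (x : Profile d) : Profile d :=
  WithLp.toLp 2 (fun i => G.partialGrad i x)

/-- `F_* = max_i max_x |fᵢ(x)|²`. -/
def Fstar (G : Game d) : ℝ :=
  sSup {s : ℝ | ∃ i, ∃ x ∈ G.domain, s = |G.cost i x| ^ 2}

/-- The standing assumptions, except for the Lipschitz continuity of the Jacobians. -/
structure Standing (G : Game d) (α β r R : ℝ) : Prop where
  alpha_pos : 0 < α
  beta_nonneg : 0 ≤ β
  r_pos : 0 < r
  R_pos : 0 < R
  closed_X : ∀ i, IsClosed (G.X i)
  convex_X : ∀ i, Convex ℝ (G.X i)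
  closed_D : ∀ i, IsClosed (G.D i)
  convex_D : ∀ i, Convex ℝ (G.D i)
  X_subset_D : ∀ i, G.X i ⊆ G.D i
  ball_subset : Metric.closedBall (0 : Profile d) r ⊆ G.strategies
  subset_ball : G.strategies ⊆ Metric.closedBall (0 : Profile d) R
  cost_convex : ∀ i, ∀ x ∈ G.domain, ConvexOn ℝ (G.D i) (fun z => G.cost i (replace x i z))
  cost_contDiff : ∀ i, ∀ x ∈ G.domain,
    ContDiffOn ℝ 1 (fun z => G.cost i (replace x i z)) (G.D i)
  grad_lipschitz : ∀ i, ∀ x ∈ G.domain, ∀ x' ∈ G.domain,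
    ‖G.partialGrad i x - G.partialGrad i x'‖ ≤ β * ‖x - x'‖
  strongly_monotone : ∀ x ∈ G.domain, ∀ x' ∈ G.domain,
    α * ‖x - x'‖ ^ 2 ≤ inner ℝ (G.gradMap x - G.gradMap x') (x - x')
  cost_bounded : ∀ i, BddAbove ((fun x => |G.cost i x| ^ 2) '' G.domain)
  cost_measurable : ∀ i, Measurable (G.domain.domRestrict (G.cost i))

/-- The Jacobian of each `∇ᵢ fᵢ` exists and is `L`-Lipschitz in operator norm. -/
def JacobianLipschitz (G : Game d) (L : ℝ) : Prop :=
  ∀ i, DifferentiableOn ℝ (G.partialGrad i) G.domain ∧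
    ∀ x ∈ G.domain, ∀ x' ∈ G.domain,
      ‖fderivWithin ℝ (G.partialGrad i) G.domain x -
        fderivWithin ℝ (G.partialGrad i) G.domain x'‖ ≤ L * ‖x - x'‖

end Game

/-- The unit sphere of `ℝ^m`. -/
abbrev USphere (m : ℕ) : Type := Metric.sphere (0 : EuclideanSpace ℝ (Fin m)) 1

/-- The uniform distribution on the unit sphere of `ℝ^m` (`m ≥ 1`): normalized surface measure. -/
def uniformSphere (m : ℕ) : MeasureTheory.Measure (USphere m) :=
  ((MeasureTheory.volume : MeasureTheory.Measure (EuclideanSpace ℝ (Fin m))).toSphere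
    Set.univ)⁻¹ •
    (MeasureTheory.volume : MeasureTheory.Measure (EuclideanSpace ℝ (Fin m))).toSphere

/-- The nearest point of `K` to `u` (it exists and is unique for `K` nonempty, closed, convex). -/
def nearestPoint {m : ℕ} (K : Set (EuclideanSpace ℝ (Fin m))) (u : EuclideanSpace ℝ (Fin m)) :
    EuclideanSpace ℝ (Fin m) :=
  Classical.epsilon (fun z => z ∈ K ∧ ∀ w ∈ K, ‖u - z‖ ≤ ‖u - w‖)

namespace Game

variable {n : ℕ} {d : Fin n → ℕ}

/-- The played profile `x + δ v`. -/
def query (δ : ℝ) (x : Profile d) (v : ∀ i, USphere (d i)) : Profile d :=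
  WithLp.toLp 2 (fun i => x i + δ • (v i : EuclideanSpace ℝ (Fin (d i))))

/-- The one-point gradient estimate `ĝᵢ = (dᵢ / δ) fᵢ(x + δ v) vᵢ`. -/
def gradEst (G : Game d) (δ : ℝ) (x : Profile d) (v : ∀ i, USphere (d i)) (i : Fin n) :
    EuclideanSpace ℝ (Fin (d i)) :=
  ((d i : ℝ) / δ * G.cost i (query δ x v)) • (v i : EuclideanSpace ℝ (Fin (d i)))

/-- One iteration: `xᵢ ↦ proj_{(1-δ)Xᵢ} (xᵢ - η ĝᵢ)` for all players simultaneously. -/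
def dfoStep (G : Game d) (δ η : ℝ) (x : Profile d) (v : ∀ i, USphere (d i)) : Profile d :=
  WithLp.toLp 2 (fun i => nearestPoint ((1 - δ) • G.X i) (x i - η • G.gradEst δ x v i))

/-- Derivative free gradient play: `dfo G η δ v x₀ T` is the output `x^T` after the iterations
`t = 0, …, T - 1`; iteration `t` uses the step size `η t` and the sampled directions `v t`. -/
def dfo (G : Game d) (η : ℕ → ℝ) (δ : ℝ) (v : ℕ → ∀ i, USphere (d i)) (x₀ : Profile d) :
    ℕ → Profile d
  | 0 => x₀
  | t + 1 => G.dfoStep δ (η t) (G.dfo η δ v x₀ t) (v t)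

/-- `A = 8 F_* d² n / α²`, with `d = d₁ + ⋯ + dₙ`. -/
def constA (G : Game d) (α : ℝ) : ℝ :=
  8 * G.Fstar * ((∑ i, d i : ℕ) : ℝ) ^ 2 * n / α ^ 2

end Game

/-- `B = 2 ((1 + β √n / α) R + β n / α)²`. -/
def constB (n : ℕ) (α β R : ℝ) : ℝ :=
  2 * ((1 + β * √(n : ℝ) / α) * R + β * n / α) ^ 2

/-- `min {r, α / (2 L n^{3/2})}`, where the second term is `+∞` when `L = 0`. -/
def initialRadius (n : ℕ) (α L r : ℝ) : ℝ :=
  if L = 0 then r else min r (α / (2 * L * (n : ℝ) ^ (3 / 2 : ℝ)))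

/-- The query radius of epoch `k ≥ 1`: `δ_k = q^{k-1} δ₁`. The index is shifted:
`epochRadius δ₁ q j` is `δ_{j+1}`. -/
def epochRadius (δ₁ q : ℝ) : ℕ → ℝ
  | 0 => δ₁
  | j + 1 => q * epochRadius δ₁ q j

/-- The length `⌈max {A / (B δ⁴), 4 R² / (B δ²)}⌉` of an epoch with query radius `δ`. -/
def epochLength (A B R δ : ℝ) : ℕ :=
  ⌈max (A / (B * δ ^ 4)) (4 * R ^ 2 / (B * δ ^ 2))⌉₊

namespace Game

variable {n : ℕ} {d : Fin n → ℕ}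

/-- The restarted process: `y⁰ = x₀` and `y^{j+1}` is the output of the algorithm started at `y^j`
with radius `δ_{j+1}` and horizon `T_{j+1}`. The directions `v (j+1) t` are used in iteration `t`
of epoch `j+1`. -/
def restart (G : Game d) (η : ℕ → ℝ) (A B R δ₁ q : ℝ) (v : ℕ → ℕ → ∀ i, USphere (d i))
    (x₀ : Profile d) : ℕ → Profile d
  | 0 => x₀
  | j + 1 => G.dfo η (epochRadius δ₁ q j) (v (j + 1)) (G.restart η A B R δ₁ q v x₀ j)
      (epochLength A B R (epochRadius δ₁ q j))

end Game

/-- The number `T₁ + ⋯ + T_k` of iterations performed to generate `y^k`. -/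
def totalSteps (A B R δ₁ q : ℝ) (k : ℕ) : ℕ :=
  ∑ j ∈ Finset.range k, epochLength A B R (epochRadius δ₁ q j)

/-- The accuracy `ε_k = 2 B δ₁² q^{2(k-1)}` of epoch `k ≥ 1`. -/
def epochAccuracy (B δ₁ q : ℝ) (k : ℕ) : ℝ :=
  2 * B * δ₁ ^ 2 * q ^ (2 * (k - 1))

end

/-! The one-point estimate is an unbiased sample of a smoothed gradient. Integrating `fᵢ` over the
sphere of player `i`'s own direction, the divergence theorem on the ball turns `(dᵢ/δ) E[fᵢ(x + δv)
vᵢ]` into the mean of `∇ᵢfᵢ(x + δu)`, where `uᵢ` is uniform on the ball and the other `uⱼ` stay on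
their spheres (`Standing.integral_inner_gradEst`). Within an epoch the algorithm is therefore
projected stochastic approximation for the map `smoothGrad` on the shrunk set, and the squared norm
of its estimates is at most `d² F_* / δ²`.

For radii up to `δ₁` the map `smoothGrad` is `α/2`-strongly monotone: the Lipschitz Jacobians bound
its deviation from the true gradient map through second differences, and for one player it is an
average of translates of a strongly monotone map. Its variational inequality thus has a solution
`z`, and comparison through the point `(1 - δ) x⋆` gives `‖z - x⋆‖² ≤ B δ² / 2`
(`Standing.norm_sub_nash_le`).

The mean squared distance `e t` to `z` obeys `e (t+1) ≤ (1 - 2/t) e t + C/t²` with `C = 4 d² F_* /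
(α² δ²)`. The factor vanishes at `t = 2`, which erases the past, and `e t ≤ C/t` holds from `t = 3`
on whatever the starting point. The epoch length makes `2C/T ≤ B δ²`; added to twice the squared
bias this is the claimed `2 B δ²` (`Standing.integral_epoch_le`). Each epoch stands alone: from its
predecessor it only needs a starting point in the shrunk set that depends on earlier directions.

The bounds on the epoch lengths grow geometrically, so their sum is controlled by the last epoch;
rounding up adds one per epoch, which is the logarithmic term (`totalSteps_le`). For a given `ε` one
stops at the first epoch of accuracy at most `ε`, which overshoots by at most a factor `q²`. -/

namespace BallDivergence

/-! ### The divergence theorem on the unit ball, by radial cutoffs. -/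

open MeasureTheory Measure Metric Set Filter Topology
open Module (finrank)

variable {E : Type*} [NormedAddCommGroup E] [InnerProductSpace ℝ E] [FiniteDimensional ℝ E]

/-- The product of a bounded function with the cutoff `(1 - ‖x‖^(2k+2))²` inside the unit ball,
extended by zero, is differentiable everywhere. -/
theorem hasLineDerivAt_cutoff {f : E → ℝ} {f' : E → E} (k : ℕ) {C : ℝ}
    (hfC : ∀ x ∈ ball (0 : E) 1, |f x| ≤ C)
    (hf' : ∀ x ∈ ball (0 : E) 1, HasGradientAt f (f' x) x) (e x : E) :
    HasLineDerivAt ℝ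
      ((ball (0 : E) 1).indicator fun x => (1 - (‖x‖ ^ 2) ^ (k + 1)) ^ 2 * f x)
      ((ball (0 : E) 1).indicator (fun x => (1 - (‖x‖ ^ 2) ^ (k + 1)) ^ 2 * inner ℝ (f' x) e
        - 4 * (k + 1) * (1 - (‖x‖ ^ 2) ^ (k + 1)) * (‖x‖ ^ 2) ^ k * inner ℝ x e * f x) x)
      x e := by
  have hC : 0 ≤ C := (abs_nonneg _).trans (hfC 0 (by simp))
  by_cases hx : x ∈ ball (0 : E) 1
  · rw [indicator_of_mem hx]
    have h1 : HasFDerivAt (fun x : E => ‖x‖ ^ 2) (2 • innerSL ℝ x) x :=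
      (hasStrictFDerivAt_norm_sq x).hasFDerivAt
    have h2 := (((h1.pow (k + 1)).const_sub 1).pow 2).mul (hf' x hx).hasFDerivAt
    have h3 := h2.hasLineDerivAt e
    refine (h3.congr_of_eventuallyEq (f₁ := _) ?_).congr_deriv ?_
    · filter_upwards [isOpen_ball.mem_nhds hx] with y hy
      rw [indicator_of_mem hy]
      rfl
    · simp [InnerProductSpace.toDual_apply_apply]
      ring
  · rw [indicator_of_notMem hx]
    have hx1 : 1 ≤ ‖x‖ := by simpa using hx
    -- Because the cutoff is squared, the product is quadratically small in the distance to the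
    -- sphere, so at a point outside the open ball the derivative exists and is zero. Only
    -- boundedness of `f` is needed there.
    suffices h : HasFDerivAt
        ((ball (0 : E) 1).indicator fun x => (1 - (‖x‖ ^ 2) ^ (k + 1)) ^ 2 * f x)
        (0 : E →L[ℝ] ℝ) x by simpa using h.hasLineDerivAt e
    rw [hasFDerivAt_iff_isLittleO_nhds_zero]
    simp only [indicator_of_notMem hx, sub_zero, _root_.zero_apply]
    have key : ∀ h : E, ‖(ball (0 : E) 1).indicator
        (fun x => (1 - (‖x‖ ^ 2) ^ (k + 1)) ^ 2 * f x) (x + h)‖ ≤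
        (C * (2 * (k + 1)) ^ 2) * ‖‖h‖ ^ 2‖ := by
      intro h
      by_cases hy : x + h ∈ ball (0 : E) 1
      · rw [indicator_of_mem hy]
        have hy1 : ‖x + h‖ < 1 := by simpa using hy
        have h1 : 1 - ‖x + h‖ ≤ ‖h‖ := by
          have := norm_sub_norm_le x (x + h)
          simp only [sub_add_cancel_left, norm_neg] at this
          linarith
        have h2 : 1 - (‖x + h‖ ^ 2) ^ (k + 1) ≤ 2 * (k + 1) * (1 - ‖x + h‖) := by
          -- Bernoulli's inequality for `(1 + (‖x + h‖ - 1)) ^ (2(k+1))`.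
          have := one_add_mul_le_pow (a := ‖x + h‖ - 1) (by linarith [norm_nonneg (x + h)])
            (2 * (k + 1))
          rw [add_sub_cancel, pow_mul] at this
          push_cast at this
          linarith
        have h3 : 0 ≤ 1 - (‖x + h‖ ^ 2) ^ (k + 1) := by
          have := pow_le_one₀ (n := k + 1) (by positivity : 0 ≤ ‖x + h‖ ^ 2)
            (pow_le_one₀ (norm_nonneg _) hy1.le)
          linarith
        have h4 : 1 - (‖x + h‖ ^ 2) ^ (k + 1) ≤ 2 * (k + 1) * ‖h‖ :=
          h2.trans (mul_le_mul_of_nonneg_left h1 (by positivity))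
        rw [norm_mul, norm_pow, Real.norm_eq_abs, Real.norm_eq_abs, abs_of_nonneg h3, norm_pow,
          norm_norm]
        calc _ ≤ (2 * (k + 1) * ‖h‖) ^ 2 * C := by
              gcongr
              exact hfC _ hy
          _ = _ := by ring
      · rw [indicator_of_notMem hy, norm_zero]
        positivity
    refine (Asymptotics.IsBigO.of_bound _ (.of_forall key)).trans_isLittleO ?_
    have := Asymptotics.isLittleO_norm_pow_id (E' := E) (n := 2) one_lt_two
    exact this

variable [MeasurableSpace E] [BorelSpace E]
  (μ : Measure E) [μ.IsAddHaarMeasure]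

/-- Integration in polar coordinates. -/
theorem integral_eq_integral_sphere [Nontrivial E] {g : E → ℝ} (hg : Integrable g μ) :
    ∫ x, g x ∂μ =
      ∫ v, (∫ r in Ioi (0 : ℝ), r ^ (finrank ℝ E - 1) * g (r • (v : E))) ∂μ.toSphere := by
  have hmp := μ.measurePreserving_homeomorphUnitSphereProd
  have hemb := (homeomorphUnitSphereProd E).measurableEmbedding
  let G : sphere (0 : E) 1 × Ioi (0 : ℝ) → ℝ := fun p => g (p.2.1 • (p.1 : E))
  have hG : ∀ x, G (homeomorphUnitSphereProd E x) = g x := by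
    intro x
    have := congrArg Subtype.val ((homeomorphUnitSphereProd E).symm_apply_apply x)
    rw [homeomorphUnitSphereProd_symm_apply_coe] at this
    simp only [G]
    rw [this]
  have hint : Integrable G (μ.toSphere.prod (volumeIoiPow (finrank ℝ E - 1))) := by
    rw [← hmp.integrable_comp_emb hemb]
    have h1 : Integrable (g ∘ (Subtype.val : ({0}ᶜ : Set E) → E)) (μ.comap (↑)) :=
      (integrableOn_iff_comap_subtypeVal (measurableSet_singleton _).compl).1 hg.integrableOn
    exact h1.congr (.of_forall fun x => (hG x).symm)
  calc ∫ x, g x ∂μ = ∫ x : ({(0)}ᶜ : Set E), g x ∂(μ.comap (↑)) := by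
        rw [integral_subtype_comap (measurableSet_singleton _).compl g, restrict_compl_singleton]
    _ = ∫ p, G p ∂(μ.toSphere.prod (volumeIoiPow (finrank ℝ E - 1))) := by
        rw [← hmp.integral_comp hemb]
        simp only [hG]
    _ = ∫ v, ∫ r, G (v, r) ∂(volumeIoiPow (finrank ℝ E - 1)) ∂μ.toSphere :=
        integral_prod _ hint
    _ = _ := by
        refine integral_congr_ae (.of_forall fun v => ?_)
        simp only [G, Measure.volumeIoiPow, ENNReal.ofReal]
        rw [integral_withDensity_eq_integral_smul,
          integral_subtype_comap measurableSet_Ioi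
            fun a ↦ Real.toNNReal (a ^ (finrank ℝ E - 1)) • g (a • (v : E)),
          setIntegral_congr_fun measurableSet_Ioi fun x hx ↦ ?_]
        · simp only [NNReal.smul_def, smul_eq_mul]
          rw [Real.coe_toNNReal _ (pow_nonneg (le_of_lt hx) _)]
        · exact (measurable_subtype_coe.pow_const _).real_toNNReal

/-- The radial density `-h'` of the cutoff `h r = (1 - r^(2k+2))²`. -/
def peak (k : ℕ) (r : ℝ) : ℝ := 4 * (k + 1) * (1 - (r ^ 2) ^ (k + 1)) * (r ^ 2) ^ k * r

theorem continuous_peak (k : ℕ) : Continuous (peak k) := by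
  unfold peak; fun_prop

theorem peak_nonneg (k : ℕ) {r : ℝ} (hr : r ∈ Icc (0 : ℝ) 1) : 0 ≤ peak k r := by
  have := pow_le_one₀ (n := k + 1) (sq_nonneg r) (pow_le_one₀ hr.1 hr.2)
  have h0 := hr.1
  unfold peak
  have : 0 ≤ 1 - (r ^ 2) ^ (k + 1) := by linarith
  positivity

theorem integral_peak (k : ℕ) : ∫ r in Icc (0 : ℝ) 1, peak k r = 1 := by
  rw [integral_Icc_eq_integral_Ioc, ← intervalIntegral.integral_of_le zero_le_one]
  rw [intervalIntegral.integral_eq_sub_of_hasDerivAt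
    (f := fun r : ℝ => -(1 - (r ^ 2) ^ (k + 1)) ^ 2) (f' := peak k)]
  · simp
  · intro r _
    have h1 := ((((hasDerivAt_pow 2 r).pow (k + 1)).const_sub 1).pow 2).neg
    refine h1.congr_deriv ?_
    simp [peak]
    ring
  · exact (continuous_peak k).intervalIntegrable _ _

/-- The radial densities concentrate at `r = 1`. -/
theorem tendsto_integral_peak {g : ℝ → ℝ} (hg : ContinuousOn g (Icc 0 1)) :
    Tendsto (fun k : ℕ => ∫ r in Icc (0 : ℝ) 1, peak k r * g r) atTop (𝓝 (g 1)) := by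
  refine tendsto_setIntegral_peak_smul_of_integrableOn_of_tendsto (x₀ := (1 : ℝ))
    measurableSet_Icc (t := Icc (0 : ℝ) 1) measurableSet_Icc subset_rfl self_mem_nhdsWithin
    (by simp) (.of_forall fun k x hx => peak_nonneg k hx) ?_ ?_
    (.of_forall fun k => (continuous_peak k).aestronglyMeasurable)
    (hg.integrableOn_compact isCompact_Icc) (hg 1 (by simp))
  · intro u hu hu1
    obtain ⟨ε, hε, hεu⟩ := Metric.isOpen_iff.1 hu 1 hu1
    rw [Metric.tendstoUniformlyOn_iff]
    intro c hc
    -- Away from `1` the radius is at most `ρ < 1`, so the density is at most `4(k+1) ρ^(2k)`. The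
    -- maximum with `0` covers `ε > 1`.
    let ρ : ℝ := max (1 - ε) 0
    have hρ0 : 0 ≤ ρ := le_max_right _ _
    have hρ1 : ρ < 1 := max_lt (by linarith) one_pos
    have hlim : Tendsto (fun k : ℕ => 4 * (((k : ℝ) * (ρ ^ 2) ^ k) + (ρ ^ 2) ^ k))
        atTop (𝓝 0) := by
      have h1 := tendsto_self_mul_const_pow_of_lt_one (sq_nonneg ρ)
        (pow_lt_one₀ hρ0 hρ1 two_ne_zero)
      have h2 := tendsto_pow_atTop_nhds_zero_of_lt_one (sq_nonneg ρ)
        (pow_lt_one₀ hρ0 hρ1 two_ne_zero)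
      simpa using (h1.add h2).const_mul 4
    filter_upwards [hlim.eventually (gt_mem_nhds hc)] with k hk r hr
    have hr01 : r ∈ Icc (0 : ℝ) 1 := hr.1
    have hrρ : r ≤ ρ := by
      by_contra h
      push Not at h
      refine hr.2 (hεu ?_)
      rw [mem_ball, Real.dist_eq, abs_sub_comm, abs_of_nonneg (by linarith [hr01.2])]
      linarith [le_max_left (1 - ε) 0]
    have h3 : peak k r ≤ 4 * (k + 1) * 1 * (ρ ^ 2) ^ k * 1 := by
      unfold peak
      have h0 := hr01.1
      have h5 := pow_le_one₀ (n := k + 1) (sq_nonneg r) (pow_le_one₀ hr01.1 hr01.2)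
      have h6 : 0 ≤ (r ^ 2) ^ (k + 1) := by positivity
      gcongr
      · linarith
      · exact hr01.2
    rw [Pi.zero_apply, dist_zero_left, Real.norm_eq_abs, abs_of_nonneg (peak_nonneg k hr01)]
    linarith
  · simp only [integral_peak]
    exact tendsto_const_nhds

/-- The directional derivative of the cutoff times `f`, extended by zero, has integral zero; the
product rule splits it into these two terms. The cutoff avoids any regularity of `f'` up to the
boundary. -/
theorem integral_cutoff_mul_inner_gradient {f : E → ℝ} {f' : E → E} (k : ℕ) {C M : ℝ}
    (hfm : Measurable f) (hfC : ∀ x, |f x| ≤ C)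
    (hf' : ∀ x ∈ ball (0 : E) 1, HasGradientAt f (f' x) x)
    (hf'c : ContinuousOn f' (ball 0 1)) (hf'M : ∀ x ∈ ball (0 : E) 1, ‖f' x‖ ≤ M) (e : E) :
    ∫ x in ball (0 : E) 1, (1 - (‖x‖ ^ 2) ^ (k + 1)) ^ 2 * inner ℝ (f' x) e ∂μ =
      ∫ x in ball (0 : E) 1,
        4 * (k + 1) * (1 - (‖x‖ ^ 2) ^ (k + 1)) * (‖x‖ ^ 2) ^ k * inner ℝ x e * f x ∂μ ∧
    Integrable ((ball (0 : E) 1).indicator fun x =>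
        4 * (k + 1) * (1 - (‖x‖ ^ 2) ^ (k + 1)) * (‖x‖ ^ 2) ^ k * inner ℝ x e * f x) μ := by
  have hM : 0 ≤ M := (norm_nonneg _).trans (hf'M 0 (by simp))
  have hc1 : ∀ x ∈ ball (0 : E) 1, |1 - (‖x‖ ^ 2) ^ (k + 1)| ≤ 1 := by
    intro x hx
    have hx1 : ‖x‖ < 1 := by simpa using hx
    have := pow_le_one₀ (n := k + 1) (by positivity : 0 ≤ ‖x‖ ^ 2)
            (pow_le_one₀ (norm_nonneg _) hx1.le)
    have h2 : 0 ≤ (‖x‖ ^ 2) ^ (k + 1) := by positivity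
    rw [abs_le]; constructor <;> linarith
  have hfin : μ (ball (0 : E) 1) ≠ ⊤ := measure_ball_lt_top.ne
  have i1 : IntegrableOn (fun x => (1 - (‖x‖ ^ 2) ^ (k + 1)) ^ 2 * inner ℝ (f' x) e)
      (ball (0 : E) 1) μ := by
    refine IntegrableOn.of_bound hfin.lt_top ?_ (1 ^ 2 * (M * ‖e‖)) ?_
    · refine ContinuousOn.aestronglyMeasurable ?_ measurableSet_ball
      refine ContinuousOn.mul (by fun_prop) ?_
      exact hf'c.inner continuousOn_const
    · refine (ae_restrict_mem measurableSet_ball).mono fun x hx => ?_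
      rw [norm_mul, norm_pow, Real.norm_eq_abs]
      gcongr
      · exact hc1 x hx
      · exact (norm_inner_le_norm _ _).trans (by gcongr; exact hf'M x hx)
  have i2 : IntegrableOn (fun x =>
      4 * (k + 1) * (1 - (‖x‖ ^ 2) ^ (k + 1)) * (‖x‖ ^ 2) ^ k * inner ℝ x e * f x)
      (ball (0 : E) 1) μ := by
    refine IntegrableOn.of_bound hfin.lt_top ?_ (4 * (k + 1) * 1 * 1 * (1 * ‖e‖) * C) ?_
    · refine Measurable.aestronglyMeasurable ?_
      have : Measurable fun x : E =>
        4 * (k + 1) * (1 - (‖x‖ ^ 2) ^ (k + 1)) * (‖x‖ ^ 2) ^ k * inner ℝ x e :=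
        Continuous.measurable (by fun_prop)
      exact this.mul hfm
    · refine (ae_restrict_mem measurableSet_ball).mono fun x hx => ?_
      have hx1 : ‖x‖ < 1 := by simpa using hx
      have h4 : ‖(4 * (k + 1) : ℝ)‖ = 4 * (k + 1) := by
        rw [Real.norm_eq_abs, abs_of_nonneg (by positivity)]
      simp only [norm_mul _ (f x), norm_mul _ (inner ℝ x e), norm_mul _ ((‖x‖ ^ 2) ^ k),
        norm_mul _ (1 - (‖x‖ ^ 2) ^ (k + 1)), h4]
      gcongr
      · exact hc1 x hx
      · rw [norm_pow, norm_pow, norm_norm]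
        exact pow_le_one₀ (by positivity) (pow_le_one₀ (norm_nonneg _) hx1.le)
      · exact (norm_inner_le_norm _ _).trans (by gcongr)
      · exact hfC x
  refine ⟨?_, (integrable_indicator_iff measurableSet_ball).2 i2⟩
  have hline := hasLineDerivAt_cutoff k (fun x _ => hfC x) hf' e
  have i3 : IntegrableOn (fun x => (1 - (‖x‖ ^ 2) ^ (k + 1)) ^ 2 * f x) (ball (0 : E) 1) μ := by
    refine IntegrableOn.of_bound hfin.lt_top ?_ (1 ^ 2 * C) ?_
    · have : Measurable fun x : E => (1 - (‖x‖ ^ 2) ^ (k + 1)) ^ 2 :=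
        Continuous.measurable (by fun_prop)
      exact (this.mul hfm).aestronglyMeasurable
    · refine (ae_restrict_mem measurableSet_ball).mono fun x hx => ?_
      rw [norm_mul, norm_pow, Real.norm_eq_abs]
      gcongr
      · exact hc1 x hx
      · exact hfC x
  -- Integration by parts against the constant function `1`.
  have key := integral_bilinear_hasLineDerivAt_right_eq_neg_left_of_integrable (μ := μ)
    (f := fun _ => (1 : ℝ)) (f' := fun _ => (0 : ℝ)) (B := ContinuousLinearMap.mul ℝ ℝ)
    (g := (ball (0 : E) 1).indicator fun x => (1 - (‖x‖ ^ 2) ^ (k + 1)) ^ 2 * f x)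
    (v := e) (by simp)
    (by
      simp only [ContinuousLinearMap.mul_apply', one_mul]
      exact (integrable_indicator_iff measurableSet_ball).2 (i1.sub i2))
    (by
      simp only [ContinuousLinearMap.mul_apply', one_mul]
      exact (integrable_indicator_iff measurableSet_ball).2 i3)
    (fun x _ => by simpa using (hasFDerivAt_const (1 : ℝ) x).hasLineDerivAt e)
    (fun x _ => hline x)
  simp only [ContinuousLinearMap.mul_apply', one_mul, zero_mul, integral_zero, neg_zero] at key
  rw [integral_indicator measurableSet_ball] at key
  have := integral_sub i1 i2
  linarith

/-- On the ray through `v`, `⟪r v, e⟫ = r ⟪v, e⟫`, and the remaining radial factor is exactly `peak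
k r`. This exhibits the boundary term as an average over spheres that concentrates on the unit
sphere. -/
theorem integral_cutoff_eq_integral_sphere_peak [Nontrivial E] {f : E → ℝ} (k : ℕ) (e : E)
    (hint : Integrable ((ball (0 : E) 1).indicator fun x =>
        4 * (k + 1) * (1 - (‖x‖ ^ 2) ^ (k + 1)) * (‖x‖ ^ 2) ^ k * inner ℝ x e * f x) μ) :
    ∫ x in ball (0 : E) 1,
        4 * (k + 1) * (1 - (‖x‖ ^ 2) ^ (k + 1)) * (‖x‖ ^ 2) ^ k * inner ℝ x e * f x ∂μ =
      ∫ v, (∫ r in Icc (0 : ℝ) 1, peak k r * (r ^ (finrank ℝ E - 1) * f (r • (v : E)))) *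
        inner ℝ (v : E) e ∂μ.toSphere := by
  rw [← integral_indicator measurableSet_ball, integral_eq_integral_sphere μ hint]
  refine integral_congr_ae (.of_forall fun v => ?_)
  have hv : ‖(v : E)‖ = 1 := by simp
  simp only
  rw [← integral_mul_const, integral_Icc_eq_integral_Ioo,
    ← integral_indicator measurableSet_Ioo, ← integral_indicator measurableSet_Ioi]
  refine integral_congr_ae (.of_forall fun r => ?_)
  by_cases hr0 : 0 < r
  · have hn : ‖r • (v : E)‖ = r := by rw [norm_smul, hv, Real.norm_of_nonneg hr0.le, mul_one]
    by_cases hr1 : r < 1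
    · have hb : r • (v : E) ∈ ball (0 : E) 1 := by simpa [hn] using hr1
      rw [indicator_of_mem (show r ∈ Ioi (0 : ℝ) from hr0), indicator_of_mem hb,
        indicator_of_mem (show r ∈ Ioo (0 : ℝ) 1 from ⟨hr0, hr1⟩), hn, real_inner_smul_left]
      unfold peak
      ring
    · have hb : r • (v : E) ∉ ball (0 : E) 1 := by simpa [hn] using hr1
      rw [indicator_of_mem (show r ∈ Ioi (0 : ℝ) from hr0), indicator_of_notMem hb,
        indicator_of_notMem (fun h => hr1 h.2), mul_zero]
  · rw [indicator_of_notMem (show r ∉ Ioi (0 : ℝ) from hr0), indicator_of_notMem (fun h => hr0 h.1)]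

/-- Let `k → ∞` in the identity for the cutoffs. Inside the ball the cutoff tends to `1`; in polar
coordinates the radial density concentrates at `r = 1`, where continuity of `f` up to the sphere
gives its boundary value. Both limits are by dominated convergence. -/
theorem integral_sphere_mul_inner_of_measurable [Nontrivial E] {f : E → ℝ} {f' : E → E} {C M : ℝ}
    (hfm : Measurable f) (hfC : ∀ x, |f x| ≤ C) (hfc : ContinuousOn f (closedBall 0 1))
    (hf' : ∀ x ∈ ball (0 : E) 1, HasGradientAt f (f' x) x)
    (hf'c : ContinuousOn f' (ball 0 1)) (hf'M : ∀ x ∈ ball (0 : E) 1, ‖f' x‖ ≤ M) (e : E) :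
    ∫ v, f (v : E) * inner ℝ (v : E) e ∂μ.toSphere =
      ∫ x in ball (0 : E) 1, inner ℝ (f' x) e ∂μ := by
  have hM : 0 ≤ M := (norm_nonneg _).trans (hf'M 0 (by simp))
  have hC : 0 ≤ C := (abs_nonneg _).trans (hfC 0)
  have hid := fun k : ℕ => integral_cutoff_mul_inner_gradient μ k hfm hfC hf' hf'c hf'M e
  have hL : Tendsto (fun k : ℕ => ∫ x in ball (0 : E) 1,
      (1 - (‖x‖ ^ 2) ^ (k + 1)) ^ 2 * inner ℝ (f' x) e ∂μ) atTop
      (𝓝 (∫ x in ball (0 : E) 1, inner ℝ (f' x) e ∂μ)) := by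
    have : IsFiniteMeasure (μ.restrict (ball (0 : E) 1)) :=
      ⟨by simpa using measure_ball_lt_top⟩
    refine tendsto_integral_of_dominated_convergence (fun _ => 1 ^ 2 * (M * ‖e‖)) ?_
      (integrable_const _) ?_ ?_
    · intro k
      refine ContinuousOn.aestronglyMeasurable ?_ measurableSet_ball
      exact ContinuousOn.mul (by fun_prop) (hf'c.inner continuousOn_const)
    · intro k
      refine (ae_restrict_mem measurableSet_ball).mono fun x hx => ?_
      have hx1 : ‖x‖ < 1 := by simpa using hx
      rw [norm_mul, norm_pow, Real.norm_eq_abs]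
      gcongr
      · have := pow_le_one₀ (n := k + 1) (by positivity : 0 ≤ ‖x‖ ^ 2)
            (pow_le_one₀ (norm_nonneg _) hx1.le)
        have h2 : 0 ≤ (‖x‖ ^ 2) ^ (k + 1) := by positivity
        rw [abs_le]; constructor <;> linarith
      · exact (norm_inner_le_norm _ _).trans (by gcongr; exact hf'M x hx)
    · refine (ae_restrict_mem measurableSet_ball).mono fun x hx => ?_
      have hx1 : ‖x‖ < 1 := by simpa using hx
      have h1 := (tendsto_pow_atTop_nhds_zero_of_lt_one (sq_nonneg ‖x‖)
        (pow_lt_one₀ (norm_nonneg _) hx1 two_ne_zero)).comp (tendsto_add_atTop_nat 1)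
      simpa using ((h1.const_sub 1).pow 2).mul_const (inner ℝ (f' x) e)
  have hR : Tendsto (fun k : ℕ => ∫ v, (∫ r in Icc (0 : ℝ) 1,
      peak k r * (r ^ (finrank ℝ E - 1) * f (r • (v : E)))) *
        inner ℝ (v : E) e ∂μ.toSphere) atTop
      (𝓝 (∫ v, f (v : E) * inner ℝ (v : E) e ∂μ.toSphere)) := by
    refine tendsto_integral_of_dominated_convergence (fun _ => C * ‖e‖) ?_
      (integrable_const _) ?_ ?_
    · intro k
      refine AEStronglyMeasurable.mul ?_ (Continuous.aestronglyMeasurable (by fun_prop))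
      have hm : Measurable fun p : sphere (0 : E) 1 × ℝ =>
          peak k p.2 * (p.2 ^ (finrank ℝ E - 1) * f (p.2 • (p.1 : E))) := by
        refine ((continuous_peak k).measurable.comp measurable_snd).mul
          ((measurable_snd.pow_const _).mul (hfm.comp ?_))
        exact Continuous.measurable (by fun_prop)
      exact (hm.aestronglyMeasurable (μ := μ.toSphere.prod
        (volume.restrict (Icc (0 : ℝ) 1)))).integral_prod_right'
    · intro k
      refine .of_forall fun v => ?_
      have hv : ‖(v : E)‖ = 1 := by simp
      rw [norm_mul]
      refine mul_le_mul ?_ ((norm_inner_le_norm _ _).trans (by rw [hv, one_mul]))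
        (norm_nonneg _) hC
      calc _ ≤ ∫ r in Icc (0 : ℝ) 1, peak k r * C := by
            refine norm_integral_le_of_norm_le
              (((continuous_peak k).continuousOn.integrableOn_compact isCompact_Icc).mul_const _)
              ((ae_restrict_mem measurableSet_Icc).mono fun r hr => ?_)
            rw [norm_mul, Real.norm_of_nonneg (peak_nonneg k hr), norm_mul, norm_pow,
              Real.norm_of_nonneg hr.1]
            refine mul_le_mul_of_nonneg_left ?_ (peak_nonneg k hr)
            calc _ ≤ 1 * C := by
                  gcongr
                  · exact pow_le_one₀ hr.1 hr.2
                  · exact hfC _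
              _ = C := one_mul C
        _ = C := by rw [integral_mul_const, integral_peak, one_mul]
    · refine .of_forall fun v => Tendsto.mul_const _ ?_
      have hv : ‖(v : E)‖ = 1 := by simp
      have hc : ContinuousOn (fun r : ℝ => r ^ (finrank ℝ E - 1) * f (r • (v : E)))
          (Icc 0 1) := by
        refine ContinuousOn.mul (by fun_prop) (hfc.comp (by fun_prop) fun r hr => ?_)
        simp only [mem_closedBall, dist_zero_right, norm_smul, hv, mul_one]
        rw [Real.norm_of_nonneg hr.1]
        exact hr.2
      simpa using tendsto_integral_peak hc
  refine tendsto_nhds_unique hR ?_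
  simp only [← fun k => integral_cutoff_eq_integral_sphere_peak μ k e (hid k).2,
    ← fun k => (hid k).1]
  exact hL

/-- The divergence theorem on the unit ball. -/
theorem integral_sphere_mul_inner [Nontrivial E] {f : E → ℝ} {f' : E → E} {M : ℝ}
    (hfc : ContinuousOn f (closedBall 0 1))
    (hf' : ∀ x ∈ ball (0 : E) 1, HasGradientAt f (f' x) x)
    (hf'c : ContinuousOn f' (ball 0 1)) (hf'M : ∀ x ∈ ball (0 : E) 1, ‖f' x‖ ≤ M) (e : E) :
    ∫ v, f (v : E) * inner ℝ (v : E) e ∂μ.toSphere =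
      ∫ x in ball (0 : E) 1, inner ℝ (f' x) e ∂μ := by
  classical
  -- Cutting `f` off outside the closed ball supplies global measurability and boundedness without
  -- changing either side.
  let F : E → ℝ := (closedBall (0 : E) 1).piecewise f 0
  have hF : ∀ x ∈ closedBall (0 : E) 1, F x = f x := fun x hx => piecewise_eq_of_mem _ _ _ hx
  obtain ⟨C, hC⟩ := (isCompact_closedBall (0 : E) 1).exists_bound_of_continuousOn hfc
  have h := integral_sphere_mul_inner_of_measurable μ (f := F) (f' := f') (C := C) (M := M)
    (hfc.measurable_piecewise continuousOn_const measurableSet_closedBall) ?_ ?_ ?_ hf'c hf'M e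
  · rw [← h]
    refine integral_congr_ae (.of_forall fun v => ?_)
    simp only
    rw [hF _ (sphere_subset_closedBall v.2)]
  · intro x
    by_cases hx : x ∈ closedBall (0 : E) 1
    · rw [hF x hx]; exact hC x hx
    · simp only [F, piecewise_eq_of_notMem _ _ _ hx, Pi.zero_apply, abs_zero]
      exact (norm_nonneg _).trans (hC 0 (by simp))
  · exact hfc.congr hF
  · intro x hx
    refine (hf' x hx).congr_of_eventuallyEq ?_
    filter_upwards [isOpen_ball.mem_nhds hx] with y hy using hF y (ball_subset_closedBall hy)

end BallDivergence

noncomputable section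

namespace Game

open MeasureTheory Metric Set Filter Topology

/-! ### Random directions and the law of the smoothing noise. -/

section Noise

theorem uniformSphere_isProbabilityMeasure {m : ℕ} (hm : 1 ≤ m) :
    IsProbabilityMeasure (uniformSphere m) := by
  have : Nonempty (Fin m) := ⟨⟨0, hm⟩⟩
  refine ⟨?_⟩
  rw [uniformSphere, Measure.smul_apply, smul_eq_mul]
  exact ENNReal.inv_mul_cancel (Measure.measure_univ_ne_zero.2 (Measure.toSphere_ne_zero volume))
    (measure_ne_top _ _)

/-- The uniform distribution on the unit ball of `ℝ^m`. -/
def uniformBall (m : ℕ) : Measure (EuclideanSpace ℝ (Fin m)) :=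
  (volume (ball (0 : EuclideanSpace ℝ (Fin m)) 1))⁻¹ • volume.restrict (ball 0 1)

instance (m : ℕ) : IsProbabilityMeasure (uniformBall m) := by
  refine ⟨?_⟩
  rw [uniformBall, Measure.smul_apply, smul_eq_mul, Measure.restrict_apply_univ]
  exact ENNReal.inv_mul_cancel (measure_ball_pos _ _ one_pos).ne' measure_ball_lt_top.ne

theorem uniformBall_ae_mem (m : ℕ) :
    ∀ᵐ w ∂uniformBall m, w ∈ ball (0 : EuclideanSpace ℝ (Fin m)) 1 :=
  Measure.ae_smul_measure (ae_restrict_mem measurableSet_ball) _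

/-- The mean over the sphere of `f(v) ⟨v, e⟩` is `1/m` times the mean over the ball of the
directional derivative of `f`. -/
theorem integral_uniformSphere_mul_inner {m : ℕ} (hm : 1 ≤ m)
    {f : EuclideanSpace ℝ (Fin m) → ℝ}
    {f' : EuclideanSpace ℝ (Fin m) → EuclideanSpace ℝ (Fin m)} {M : ℝ}
    (hfc : ContinuousOn f (closedBall 0 1))
    (hf' : ∀ x ∈ ball (0 : EuclideanSpace ℝ (Fin m)) 1, HasGradientAt f (f' x) x)
    (hf'c : ContinuousOn f' (ball 0 1)) (hf'M : ∀ x ∈ ball 0 1, ‖f' x‖ ≤ M)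
    (e : EuclideanSpace ℝ (Fin m)) :
    (m : ℝ) * ∫ v, f v * inner ℝ (v : EuclideanSpace ℝ (Fin m)) e ∂uniformSphere m =
      ∫ x, inner ℝ (f' x) e ∂uniformBall m := by
  have : Nonempty (Fin m) := ⟨⟨0, hm⟩⟩
  have h := BallDivergence.integral_sphere_mul_inner volume hfc hf' hf'c hf'M e
  have hpos : 0 < volume.real (ball (0 : EuclideanSpace ℝ (Fin m)) 1) :=
    ENNReal.toReal_pos (measure_ball_pos _ _ one_pos).ne' measure_ball_lt_top.ne
  have hm0 : (m : ℝ) ≠ 0 := by positivity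
  rw [uniformSphere, uniformBall, integral_smul_measure, integral_smul_measure, h,
    ENNReal.toReal_inv, ENNReal.toReal_inv]
  change _ * ((Measure.toSphere volume).real univ)⁻¹ • _ = (volume.real (ball 0 1))⁻¹ • _
  -- The sphere has total mass `m` times the volume of the ball, whence the factor `m` after
  -- normalization.
  rw [Measure.toSphere_real_apply_univ, finrank_euclideanSpace_fin, smul_eq_mul, smul_eq_mul]
  field_simp

/-- Resampling one coordinate does not change a product measure. -/
theorem map_update_pi {ι : Type*} [Fintype ι] [DecidableEq ι] {γ : ι → Type*}
    [∀ i, MeasurableSpace (γ i)] (μ : ∀ i, Measure (γ i)) [∀ i, IsProbabilityMeasure (μ i)]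
    (i : ι) :
    Measurable (fun p : (∀ j, γ j) × γ i => Function.update p.1 i p.2) ∧
    ((Measure.pi μ).prod (μ i)).map (fun p => Function.update p.1 i p.2) = Measure.pi μ := by
  have hmeas : Measurable (fun p : (∀ j, γ j) × γ i => Function.update p.1 i p.2) := by
    refine measurable_pi_lambda _ fun j => ?_
    by_cases hj : j = i
    · subst hj; simpa using measurable_snd
    · simpa [hj] using! (measurable_pi_apply j).comp measurable_fst
  refine ⟨hmeas, (Measure.pi_eq fun s hs => ?_).symm⟩
  rw [Measure.map_apply hmeas (MeasurableSet.univ_pi hs)]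
  have : (fun p : (∀ j, γ j) × γ i => Function.update p.1 i p.2) ⁻¹' (univ.pi s) =
      (univ.pi (Function.update s i univ)) ×ˢ s i := by
    ext p
    simp only [mem_preimage, mem_univ_pi, mem_prod]
    constructor
    · intro h
      refine ⟨fun j => ?_, by simpa using h i⟩
      by_cases hj : j = i
      · subst hj; simp
      · simpa [hj] using h j
    · rintro ⟨h1, h2⟩ j
      by_cases hj : j = i
      · subst hj; simpa using h2
      · simpa [hj] using h1 j
  rw [this, Measure.prod_prod, Measure.pi_pi, ← Finset.prod_erase_mul _ _ (Finset.mem_univ i),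
    ← Finset.prod_erase_mul Finset.univ (fun j => μ j (s j)) (Finset.mem_univ i)]
  simp only [Function.update_self, measure_univ, mul_one]
  congr 1
  refine Finset.prod_congr rfl fun j hj => ?_
  rw [Function.update_of_ne (Finset.ne_of_mem_erase hj)]

variable {n : ℕ} {d : Fin n → ℕ}

/-- The joint law of the sampled directions. -/
def directionLaw (d : Fin n → ℕ) : Measure (∀ i, USphere (d i)) :=
  Measure.pi fun i => uniformSphere (d i)

theorem directionLaw_isProbabilityMeasure (hd : ∀ i, 1 ≤ d i) :
    IsProbabilityMeasure (directionLaw d) := by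
  have := fun i => uniformSphere_isProbabilityMeasure (hd i)
  unfold directionLaw; infer_instance

/-- The profile of directions `v`. -/
def embed (v : ∀ i, USphere (d i)) : Profile d := WithLp.toLp 2 fun i => (v i).1

/-- The law of `(w_i, v_{-i})` with `w_i` uniform on the ball and `v_{-i}` uniform on spheres. -/
def noise (d : Fin n → ℕ) (i : Fin n) : Measure (Profile d) :=
  ((directionLaw d).prod (uniformBall (d i))).map fun p => replace (embed p.1) i p.2

theorem measurable_toLp {γ : Type*} [MeasurableSpace γ]
    {f : ∀ i : Fin n, γ → EuclideanSpace ℝ (Fin (d i))} (hf : ∀ i, Measurable (f i)) :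
    Measurable fun a => (WithLp.toLp 2 fun i => f i a : Profile d) :=
  (WithLp.measurable_toLp _ _).comp (measurable_pi_lambda _ hf)

theorem replace_self (x : Profile d) (i : Fin n) (z : EuclideanSpace ℝ (Fin (d i))) :
    replace x i z i = z := by simp [replace]

theorem replace_of_ne (x : Profile d) {i j : Fin n} (h : j ≠ i)
    (z : EuclideanSpace ℝ (Fin (d i))) : replace x i z j = x j := by simp [replace, h]

theorem replace_replace (x : Profile d) (i : Fin n) (z w : EuclideanSpace ℝ (Fin (d i))) :
    replace (replace x i z) i w = replace x i w := by simp [replace]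

theorem replace_apply_self (x : Profile d) (i : Fin n) : replace x i (x i) = x := by
  simp [replace]

theorem measurable_replace_embed (i : Fin n) :
    Measurable fun p : (∀ j, USphere (d j)) × EuclideanSpace ℝ (Fin (d i)) =>
      replace (embed p.1) i p.2 := by
  refine measurable_toLp (f := fun j (p : (∀ j, USphere (d j)) × EuclideanSpace ℝ (Fin (d i))) =>
    Function.update (fun k => (p.1 k).1) i p.2 j) fun j => ?_
  by_cases hj : j = i
  · subst hj; simpa using measurable_snd
  · simpa [hj] using! measurable_subtype_coe.comp ((measurable_pi_apply j).comp measurable_fst)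

theorem noise_isProbabilityMeasure (hd : ∀ i, 1 ≤ d i) (i : Fin n) :
    IsProbabilityMeasure (noise d i) := by
  have := directionLaw_isProbabilityMeasure hd
  exact Measure.isProbabilityMeasure_map (measurable_replace_embed i).aemeasurable

theorem noise_ae (hd : ∀ i, 1 ≤ d i) (i : Fin n) : ∀ᵐ u ∂noise d i, ∀ j, ‖u j‖ ≤ 1 := by
  have := directionLaw_isProbabilityMeasure hd
  rw [noise, ae_map_iff (measurable_replace_embed i).aemeasurable]
  · have h : ∀ᵐ p ∂(directionLaw d).prod (uniformBall (d i)), p.2 ∈ ball 0 1 :=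
      Measure.quasiMeasurePreserving_snd.ae (uniformBall_ae_mem (d i))
    filter_upwards [h] with p hp j
    by_cases hj : j = i
    · subst hj
      rw [replace_self]
      exact le_of_lt (by simpa using hp)
    · rw [replace_of_ne _ hj]
      simp [embed]
  · have : {u : Profile d | ∀ j, ‖u j‖ ≤ 1} = ⋂ j, {u | ‖u j‖ ≤ 1} := by ext; simp
    rw [this]
    exact MeasurableSet.iInter fun j =>
      (isClosed_le (by fun_prop) continuous_const).measurableSet

end Noise

end Game

/-! ### The smoothed gradient and unbiasedness of the estimate. -/

namespace Game

open MeasureTheory Metric Set Filter Topology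

variable {n : ℕ} {d : Fin n → ℕ} {G : Game d} {α β r R δ : ℝ}

/-- The profiles of the game with shrunk strategy sets `(1 - δ) X_i`. -/
def shrunk (G : Game d) (δ : ℝ) : Set (Profile d) := {x | ∀ i, x i ∈ (1 - δ) • G.X i}

/-- All points within `δ` of `(1 - δ) X_i` lie in the domain of the costs. -/
def Admissible (G : Game d) (δ : ℝ) : Prop :=
  ∀ i, ∀ x ∈ (1 - δ) • G.X i, ∀ w : EuclideanSpace ℝ (Fin (d i)), ‖w‖ ≤ 1 → x + δ • w ∈ G.D i

/-- The expected gradient estimate: `∇_i f_i` averaged over the perturbations `noise d i`. -/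
def smoothGrad (G : Game d) (δ : ℝ) (x : Profile d) : Profile d :=
  WithLp.toLp 2 fun i => ∫ u, G.partialGrad i (x + δ • u) ∂noise d i

theorem Admissible.add_mem_domain (h : G.Admissible δ) {x u : Profile d} (hx : x ∈ G.shrunk δ)
    (hu : ∀ j, ‖u j‖ ≤ 1) : x + δ • u ∈ G.domain :=
  fun i => h i (x i) (hx i) (u i) (hu i)

theorem query_eq (δ : ℝ) (x : Profile d) (v : ∀ i, USphere (d i)) :
    query δ x v = x + δ • embed v := rfl

theorem norm_embed_apply (v : ∀ i, USphere (d i)) (j : Fin n) : ‖embed v j‖ = 1 := by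
  simp [embed]

theorem Admissible.query_mem_domain (h : G.Admissible δ) {x : Profile d} (hx : x ∈ G.shrunk δ)
    (v : ∀ i, USphere (d i)) : query δ x v ∈ G.domain :=
  h.add_mem_domain hx fun j => (norm_embed_apply v j).le

theorem Standing.isClosed_domain (hG : G.Standing α β r R) : IsClosed G.domain := by
  have : G.domain = ⋂ i, {x : Profile d | x i ∈ G.D i} := by ext; simp [domain]
  rw [this]
  exact isClosed_iInter fun i => (hG.closed_D i).preimage (by fun_prop)

theorem Standing.convex_domain (hG : G.Standing α β r R) : Convex ℝ G.domain :=
  fun _ hx _ hy _ _ ha hb hab i => hG.convex_D i (hx i) (hy i) ha hb hab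

theorem Standing.strategies_subset_domain (hG : G.Standing α β r R) : G.strategies ⊆ G.domain :=
  fun _ hx i => hG.X_subset_D i (hx i)

theorem Standing.zero_mem_strategies (hG : G.Standing α β r R) :
    (0 : Profile d) ∈ G.strategies :=
  hG.ball_subset (by simpa using hG.r_pos.le)

theorem Standing.zero_mem_X (hG : G.Standing α β r R) (i : Fin n) : 0 ∈ G.X i :=
  hG.zero_mem_strategies i

theorem Standing.shrunk_subset_strategies (hG : G.Standing α β r R) (hδ : 0 ≤ δ) (hδ1 : δ ≤ 1) :
    G.shrunk δ ⊆ G.strategies := by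
  intro x hx i
  obtain ⟨y, hy, hyx⟩ := hx i
  rw [← hyx]
  exact (hG.convex_X i).smul_mem_of_zero_mem (hG.zero_mem_X i) hy ⟨by linarith, by linarith⟩

theorem Standing.continuousOn_partialGrad (hG : G.Standing α β r R) (i : Fin n) :
    ContinuousOn (G.partialGrad i) G.domain := by
  have : LipschitzOnWith ⟨β, hG.beta_nonneg⟩ (G.partialGrad i) G.domain :=
    LipschitzOnWith.of_dist_le_mul fun x hx y hy => by
      rw [dist_eq_norm, dist_eq_norm]; exact hG.grad_lipschitz i x hx y hy
  exact this.continuousOn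

theorem Standing.sq_cost_le_Fstar (hG : G.Standing α β r R) (i : Fin n) {x : Profile d}
    (hx : x ∈ G.domain) : |G.cost i x| ^ 2 ≤ G.Fstar := by
  refine le_csSup ?_ ⟨i, x, hx, rfl⟩
  choose b hb using hG.cost_bounded
  obtain ⟨c, hc⟩ := (finite_range b).bddAbove
  refine ⟨c, ?_⟩
  rintro s ⟨j, y, hy, rfl⟩
  exact (hb j ⟨y, hy, rfl⟩).trans (hc ⟨j, rfl⟩)

theorem Standing.abs_cost_le (hG : G.Standing α β r R) (i : Fin n) {x : Profile d}
    (hx : x ∈ G.domain) : |G.cost i x| ≤ √G.Fstar :=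
  Real.le_sqrt_of_sq_le (hG.sq_cost_le_Fstar i hx)

/-- Costs are measurable only as functions on the domain, so a composition is usable only when it
lands there at every point, not just almost surely. -/
theorem Standing.measurable_cost_comp (hG : G.Standing α β r R) (i : Fin n) {γ : Type*}
    [MeasurableSpace γ] {g : γ → Profile d} (hg : Measurable g) (hgD : ∀ a, g a ∈ G.domain) :
    Measurable fun a => G.cost i (g a) :=
  (hG.cost_measurable i).comp (hg.subtype_mk (h := hgD))

theorem measurable_embed : Measurable (embed : (∀ i, USphere (d i)) → Profile d) :=
  measurable_toLp fun i => measurable_subtype_coe.comp (measurable_pi_apply i)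

theorem measurable_query (δ : ℝ) :
    Measurable fun p : Profile d × (∀ i, USphere (d i)) => query δ p.1 p.2 :=
  measurable_fst.add (((measurable_embed (d := d)).comp measurable_snd).const_smul δ)

theorem partialGrad_replace (X : Profile d) (i : Fin n) (z : EuclideanSpace ℝ (Fin (d i))) :
    G.partialGrad i (replace X i z) =
      gradientWithin (fun y => G.cost i (replace X i y)) (G.D i) z := by
  unfold partialGrad
  simp only [replace_replace, replace_self]

/-- The partial gradient is continuous on the closed domain, and almost every perturbed point lies
in it; nothing is known elsewhere. -/
theorem Standing.aestronglyMeasurable_partialGrad (hG : G.Standing α β r R) (hd : ∀ i, 1 ≤ d i)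
    (hδ : G.Admissible δ) {x : Profile d} (hx : x ∈ G.shrunk δ) (i j : Fin n) :
    AEStronglyMeasurable (fun u => G.partialGrad i (x + δ • u)) (noise d j) := by
  have hmem : ∀ᵐ u ∂noise d j, u ∈ (fun u : Profile d => x + δ • u) ⁻¹' G.domain := by
    filter_upwards [noise_ae hd j] with u hu using hδ.add_mem_domain hx hu
  rw [← Measure.restrict_eq_self_of_ae_mem hmem]
  refine ContinuousOn.aestronglyMeasurable ?_
    (hG.isClosed_domain.preimage (by fun_prop)).measurableSet
  exact (hG.continuousOn_partialGrad i).comp (by fun_prop) fun u hu => hu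

theorem norm_le_sqrt_of_forall_norm_le {u : Profile d} {c : ℝ} (hc : 0 ≤ c)
    (hu : ∀ j, ‖u j‖ ≤ c) : ‖u‖ ≤ √n * c := by
  rw [PiLp.norm_eq_of_L2]
  calc √(∑ i, ‖u i‖ ^ 2) ≤ √(n * c ^ 2) := by
        refine Real.sqrt_le_sqrt ?_
        calc ∑ i, ‖u i‖ ^ 2 ≤ ∑ _i : Fin n, c ^ 2 :=
              Finset.sum_le_sum fun i _ => pow_le_pow_left₀ (norm_nonneg _) (hu i) 2
          _ = n * c ^ 2 := by simp
    _ = √n * c := by rw [Real.sqrt_mul (by positivity), Real.sqrt_sq hc]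

theorem Standing.norm_partialGrad_sub_le (hG : G.Standing α β r R) (hδ0 : 0 ≤ δ) (hδ1 : δ ≤ 1)
    (hδ : G.Admissible δ) {x u : Profile d} (hx : x ∈ G.shrunk δ) (hu : ∀ j, ‖u j‖ ≤ 1)
    (i : Fin n) : ‖G.partialGrad i (x + δ • u) - G.partialGrad i x‖ ≤ β * (δ * √n) := by
  refine (hG.grad_lipschitz i _ (hδ.add_mem_domain hx hu) _
    (hG.strategies_subset_domain (hG.shrunk_subset_strategies hδ0 hδ1 hx))).trans ?_
  rw [add_sub_cancel_left, norm_smul, Real.norm_of_nonneg hδ0]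
  have := norm_le_sqrt_of_forall_norm_le zero_le_one hu
  have := hG.beta_nonneg
  gcongr
  linarith

theorem Standing.integrable_partialGrad (hG : G.Standing α β r R) (hd : ∀ i, 1 ≤ d i)
    (hδ0 : 0 ≤ δ) (hδ1 : δ ≤ 1) (hδ : G.Admissible δ) {x : Profile d} (hx : x ∈ G.shrunk δ)
    (i j : Fin n) : Integrable (fun u => G.partialGrad i (x + δ • u)) (noise d j) := by
  have := noise_isProbabilityMeasure hd j
  refine Integrable.of_bound (hG.aestronglyMeasurable_partialGrad hd hδ hx i j)
    (‖G.partialGrad i x‖ + β * (δ * √n)) ?_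
  filter_upwards [noise_ae hd j] with u hu
  have h1 := hG.norm_partialGrad_sub_le hδ0 hδ1 hδ hx hu i
  have h2 := norm_le_norm_add_norm_sub (G.partialGrad i x) (G.partialGrad i (x + δ • u))
  rw [norm_sub_rev] at h2
  linarith

/-- The divergence theorem in the `i`-th coordinate behind the unbiasedness of the estimate. -/
theorem Standing.integral_uniformSphere_cost (hG : G.Standing α β r R) (hd : ∀ i, 1 ≤ d i)
    (hδ0 : 0 < δ) (hδ : G.Admissible δ) {x : Profile d} (hx : x ∈ G.shrunk δ) (i : Fin n)
    (v : ∀ j, USphere (d j)) (e : EuclideanSpace ℝ (Fin (d i))) :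
    ∫ u, ((d i : ℝ) / δ * G.cost i (query δ x (Function.update v i u))) *
        inner ℝ (u : EuclideanSpace ℝ (Fin (d i))) e ∂uniformSphere (d i) =
      ∫ w, inner ℝ (G.partialGrad i (x + δ • replace (embed v) i w)) e ∂uniformBall (d i) := by
  have hrep : ∀ w, x + δ • replace (embed v) i w = replace (query δ x v) i (x i + δ • w) := by
    intro w
    refine PiLp.ext fun j => ?_
    by_cases hj : j = i
    · subst hj; simp [replace_self]
    · simp [replace_of_ne _ hj, query_eq]
  have hupd : ∀ u : USphere (d i),
      query δ x (Function.update v i u) = replace (query δ x v) i (x i + δ • u.1) := by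
    intro u
    rw [← hrep, query_eq]
    congr 2
    refine PiLp.ext fun j => ?_
    by_cases hj : j = i
    · subst hj; simp [replace_self, embed]
    · simp [replace_of_ne _ hj, embed, hj]
  set X := query δ x v with hX
  have hXD : X ∈ G.domain := hδ.query_mem_domain hx v
  let φ : EuclideanSpace ℝ (Fin (d i)) → ℝ := fun z => G.cost i (replace X i z)
  have hφ : ContDiffOn ℝ 1 φ (G.D i) := hG.cost_contDiff i X hXD
  have hmaps : MapsTo (fun w => x i + δ • w) (closedBall 0 1) (G.D i) := fun w hw =>
    hδ i (x i) (hx i) w (by simpa using hw)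
  have hmem : ∀ w : EuclideanSpace ℝ (Fin (d i)), ‖w‖ ≤ 1 →
      x + δ • replace (embed v) i w ∈ G.domain := by
    intro w hw
    refine hδ.add_mem_domain hx fun j => ?_
    by_cases hj : j = i
    · subst hj; rwa [replace_self]
    · rw [replace_of_ne _ hj]; exact (norm_embed_apply v j).le
  -- The chain rule for `w ↦ xᵢ + δ w` gives the factor `δ`, which cancels the `1/δ` of the
  -- estimate; the `dᵢ` cancels against the ratio of sphere to ball.
  let f' : EuclideanSpace ℝ (Fin (d i)) → EuclideanSpace ℝ (Fin (d i)) := fun w =>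
    δ • G.partialGrad i (x + δ • replace (embed v) i w)
  have hrepc : Continuous fun w => x + δ • replace (embed v) i w := by
    refine continuous_const.add (Continuous.const_smul ?_ δ)
    unfold replace
    exact (PiLp.continuous_toLp 2 _).comp (continuous_const.update i continuous_id)
  have hf'c : ContinuousOn f' (closedBall 0 1) := by
    refine ContinuousOn.const_smul ?_ δ
    exact (hG.continuousOn_partialGrad i).comp hrepc.continuousOn
      fun w hw => hmem w (by simpa using hw)
  obtain ⟨M, hM⟩ := (isCompact_closedBall _ _).exists_bound_of_continuousOn hf'c
  have hgrad : ∀ w ∈ ball (0 : EuclideanSpace ℝ (Fin (d i))) 1,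
      HasGradientAt (fun w => φ (x i + δ • w)) (f' w) w := by
    intro w hw
    -- For `w` in the open ball the point is interior to `D i`, so the one-sided gradient is an
    -- ordinary gradient there.
    have hnhds : G.D i ∈ 𝓝 (x i + δ • w) := by
      have h1 : IsOpen ((fun z => δ⁻¹ • (z - x i)) ⁻¹' ball (0 : EuclideanSpace ℝ (Fin (d i))) 1) :=
        isOpen_ball.preimage (by fun_prop)
      refine mem_of_superset (h1.mem_nhds ?_) fun z hz => ?_
      · simpa [smul_smul, inv_mul_cancel₀ hδ0.ne'] using hw
      · have := hmaps (ball_subset_closedBall hz)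
        simpa [smul_smul, mul_inv_cancel₀ hδ0.ne'] using this
    have h2 : HasGradientAt φ (gradientWithin φ (G.D i) (x i + δ • w)) (x i + δ • w) := by
      have := ((hφ.differentiableOn one_ne_zero) _ (mem_of_mem_nhds hnhds)).hasGradientWithinAt
      exact (this.hasFDerivWithinAt.hasFDerivAt hnhds)
    have h3 : HasFDerivAt (fun w : EuclideanSpace ℝ (Fin (d i)) => x i + δ • w)
        (δ • ContinuousLinearMap.id ℝ _) w :=
      ((hasFDerivAt_id w).const_smul δ).const_add _
    have h4 := h2.hasFDerivAt.comp w h3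
    rw [hasGradientAt_iff_hasFDerivAt]
    refine h4.congr_fderiv ?_
    ext y
    simp only [f', hrep, partialGrad_replace]
    simp [φ]
  have hfc : ContinuousOn (fun w => φ (x i + δ • w)) (closedBall 0 1) :=
    hφ.continuousOn.comp (by fun_prop) hmaps
  have key := integral_uniformSphere_mul_inner (hd i) hfc hgrad (hf'c.mono ball_subset_closedBall)
    (fun w hw => hM w (ball_subset_closedBall hw)) e
  simp only [f', real_inner_smul_left, integral_const_mul] at key
  simp only [hupd, mul_assoc, integral_const_mul]
  change (d i : ℝ) / δ * ∫ u, φ (x i + δ • u.1) * inner ℝ u.1 e ∂uniformSphere (d i) = _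
  rw [div_mul_eq_mul_div, key, mul_div_cancel_left₀ _ hδ0.ne']

theorem Standing.measurable_gradEst (hG : G.Standing α β r R) (hδ : G.Admissible δ)
    {x : Profile d} (hx : x ∈ G.shrunk δ) (i : Fin n) :
    Measurable fun v => G.gradEst δ x v i := by
  have h1 : Measurable fun v : ∀ i, USphere (d i) => G.cost i (query δ x v) :=
    hG.measurable_cost_comp i ((measurable_query δ).comp measurable_prodMk_left)
      fun v => hδ.query_mem_domain hx v
  exact (h1.const_mul _).smul (measurable_subtype_coe.comp (measurable_pi_apply i))

theorem Standing.norm_gradEst_le (hG : G.Standing α β r R) (hδ0 : 0 < δ) (hδ : G.Admissible δ)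
    {x : Profile d} (hx : x ∈ G.shrunk δ) (v : ∀ i, USphere (d i)) (i : Fin n) :
    ‖G.gradEst δ x v i‖ ≤ d i / δ * √G.Fstar := by
  have hv : ‖(v i : EuclideanSpace ℝ (Fin (d i)))‖ = 1 := by simp
  rw [gradEst, norm_smul, norm_mul, hv, mul_one, Real.norm_of_nonneg (by positivity)]
  gcongr
  exact hG.abs_cost_le i (hδ.query_mem_domain hx v)

/-- The gradient estimates are unbiased for the smoothed gradients. -/
theorem Standing.integral_inner_gradEst (hG : G.Standing α β r R) (hd : ∀ i, 1 ≤ d i)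
    (hδ0 : 0 < δ) (hδ1 : δ ≤ 1) (hδ : G.Admissible δ) {x : Profile d} (hx : x ∈ G.shrunk δ)
    (i : Fin n) (e : EuclideanSpace ℝ (Fin (d i))) :
    ∫ v, inner ℝ (G.gradEst δ x v i) e ∂directionLaw d = inner ℝ (G.smoothGrad δ x i) e ∧
    Integrable (fun v => inner ℝ (G.gradEst δ x v i) e) (directionLaw d) := by
  have := fun i => uniformSphere_isProbabilityMeasure (hd i)
  have hprob := directionLaw_isProbabilityMeasure hd
  have hnoise := noise_isProbabilityMeasure hd i
  have hmeas : Measurable fun v => inner ℝ (G.gradEst δ x v i) e :=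
    (hG.measurable_gradEst hδ hx i).inner measurable_const
  have hint : Integrable (fun v => inner ℝ (G.gradEst δ x v i) e) (directionLaw d) := by
    refine Integrable.of_bound hmeas.aestronglyMeasurable (d i / δ * √G.Fstar * ‖e‖)
      (.of_forall fun v => (norm_inner_le_norm _ _).trans ?_)
    gcongr
    exact hG.norm_gradEst_le hδ0 hδ hx v i
  refine ⟨?_, hint⟩
  obtain ⟨hum, hu⟩ := map_update_pi (fun i => uniformSphere (d i)) i
  have hintP := hG.integrable_partialGrad hd hδ0.le hδ1 hδ hx i i
  have hintI : Integrable (fun u => inner ℝ (G.partialGrad i (x + δ • u)) e) (noise d i) :=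
    hintP.inner_const e
  -- Resample the `i`-th direction, apply the divergence theorem in that direction with the others
  -- fixed, and reassemble: the result is the mean over `noise d i`.
  calc ∫ v, inner ℝ (G.gradEst δ x v i) e ∂directionLaw d
      = ∫ p, inner ℝ (G.gradEst δ x (Function.update p.1 i p.2) i) e
          ∂(directionLaw d).prod (uniformSphere (d i)) := by
        conv_lhs => rw [directionLaw, ← hu]
        rw [integral_map hum.aemeasurable hmeas.aestronglyMeasurable]
        rfl
    _ = ∫ v, ∫ u, inner ℝ (G.gradEst δ x (Function.update v i u) i) e
          ∂uniformSphere (d i) ∂directionLaw d := by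
        refine integral_prod _ ?_
        rw [directionLaw, ← hu] at hint
        exact hint.comp_measurable hum
    _ = ∫ v, ∫ w, inner ℝ (G.partialGrad i (x + δ • replace (embed v) i w)) e
          ∂uniformBall (d i) ∂directionLaw d := by
        refine integral_congr_ae (.of_forall fun v => ?_)
        simp only
        rw [← hG.integral_uniformSphere_cost hd hδ0 hδ hx i v e]
        refine integral_congr_ae (.of_forall fun u => ?_)
        simp only [gradEst, real_inner_smul_left, Function.update_self]
    _ = ∫ u, inner ℝ (G.partialGrad i (x + δ • u)) e ∂noise d i := by
        rw [noise, integral_map (measurable_replace_embed i).aemeasurable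
          (by rw [← noise]; exact hintI.aestronglyMeasurable), integral_prod]
        rw [noise] at hintI
        exact hintI.comp_measurable (measurable_replace_embed i)
    _ = inner ℝ (G.smoothGrad δ x i) e := by
        simp_rw [real_inner_comm e]
        rw [integral_inner hintP]
        rfl

end Game
-- Projections and variational inequalities.
/-- A map onto a set with the obtuse-angle property of projections is nonexpansive. -/
theorem norm_sub_le_of_inner_nonpos {E : Type*} [NormedAddCommGroup E] [InnerProductSpace ℝ E]
    {K : Set E} {p : E → E} (hpK : ∀ u, p u ∈ K)
    (hp : ∀ u, ∀ w ∈ K, inner ℝ (u - p u) (w - p u) ≤ 0) (u v : E) :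
    ‖p u - p v‖ ≤ ‖u - v‖ := by
  have h1 := hp u (p v) (hpK v)
  have h2 := hp v (p u) (hpK u)
  have h3 : ‖p u - p v‖ ^ 2 ≤ inner ℝ (u - v) (p u - p v) := by
    rw [← real_inner_self_eq_norm_sq]
    simp only [inner_sub_left, inner_sub_right] at h1 h2 ⊢
    linarith
  have h4 := real_inner_le_norm (u - v) (p u - p v)
  by_contra h
  push Not at h
  nlinarith [norm_nonneg (p u - p v), norm_nonneg (u - v)]

/-- A strongly monotone Lipschitz map on a complete set with a nearest point projection `p` has a
solution of its variational inequality. -/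
theorem exists_variational_solution {E : Type*} [NormedAddCommGroup E] [InnerProductSpace ℝ E]
    {K : Set E} (hK : IsComplete K) (hne : K.Nonempty) {p : E → E} (hpK : ∀ u, p u ∈ K)
    (hp : ∀ u, ∀ w ∈ K, inner ℝ (u - p u) (w - p u) ≤ 0)
    {F : E → E} {m M : ℝ} (hm : 0 < m)
    (hmono : ∀ x ∈ K, ∀ y ∈ K, m * ‖x - y‖ ^ 2 ≤ inner ℝ (F x - F y) (x - y))
    (hlip : ∀ x ∈ K, ∀ y ∈ K, ‖F x - F y‖ ≤ M * ‖x - y‖) :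
    ∃ z ∈ K, ∀ w ∈ K, 0 ≤ inner ℝ (F z) (w - z) := by
  have hnonexp := norm_sub_le_of_inner_nonpos hpK hp
  -- The step `s = m / N²` minimizes the contraction bound `1 - 2sm + s²N²`, with value `1 - m²/N²`.
  -- The maximum keeps `N` positive and this value nonnegative even if `M < m`, which is possible
  -- when `K` is a single point.
  let N := max M m
  have hN : 0 < N := hm.trans_le (le_max_right _ _)
  let s := m / N ^ 2
  have hs : 0 < s := by positivity
  let c : ℝ := √(1 - m ^ 2 / N ^ 2)
  have hc0 : 0 ≤ 1 - m ^ 2 / N ^ 2 := by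
    rw [sub_nonneg, div_le_one (by positivity)]
    exact pow_le_pow_left₀ hm.le (le_max_right _ _) 2
  have hc1 : c < 1 := by
    rw [Real.sqrt_lt' one_pos]
    have : 0 < m ^ 2 / N ^ 2 := by positivity
    linarith
  let T : E → E := fun x => p (x - s • F x)
  have hT : Set.MapsTo T K K := fun x _ => hpK _
  have hcontr : ∀ x ∈ K, ∀ y ∈ K, ‖T x - T y‖ ≤ c * ‖x - y‖ := by
    intro x hx y hy
    refine (hnonexp _ _).trans ?_
    refine le_of_sq_le_sq ?_ (by positivity)
    rw [mul_pow, Real.sq_sqrt hc0]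
    have h1 := hmono x hx y hy
    have h2 : ‖F x - F y‖ ^ 2 ≤ N ^ 2 * ‖x - y‖ ^ 2 := by
      rw [← mul_pow]
      refine pow_le_pow_left₀ (norm_nonneg _) ((hlip x hx y hy).trans ?_) 2
      gcongr
      exact le_max_left _ _
    have h3 : x - s • F x - (y - s • F y) = (x - y) - s • (F x - F y) := by
      rw [smul_sub]; abel
    rw [h3, norm_sub_sq_real, real_inner_smul_right, norm_smul, mul_pow, Real.norm_of_nonneg hs.le,
      real_inner_comm]
    have h4 : s ^ 2 * ‖F x - F y‖ ^ 2 ≤ s ^ 2 * (N ^ 2 * ‖x - y‖ ^ 2) := by gcongr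
    have h5 : s ^ 2 * (N ^ 2 * ‖x - y‖ ^ 2) = m ^ 2 / N ^ 2 * ‖x - y‖ ^ 2 := by
      simp only [s]; field_simp
    have h6 : 2 * (s * (m * ‖x - y‖ ^ 2)) = 2 * (m ^ 2 / N ^ 2 * ‖x - y‖ ^ 2) := by
      simp only [s]; field_simp
    have h7 : s * (m * ‖x - y‖ ^ 2) ≤ s * inner ℝ (F x - F y) (x - y) := by gcongr
    linarith
  have hcw : ContractingWith ⟨c, Real.sqrt_nonneg _⟩ (hT.restrict T K K) := by
    refine ⟨by exact_mod_cast hc1, LipschitzWith.of_dist_le_mul fun x y => ?_⟩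
    rw [Subtype.dist_eq, Subtype.dist_eq, dist_eq_norm, dist_eq_norm]
    exact hcontr x x.2 y y.2
  obtain ⟨x₀, hx₀⟩ := hne
  obtain ⟨z, hz, hfix, -⟩ := hcw.exists_fixedPoint' hK hT hx₀ (edist_ne_top _ _)
  refine ⟨z, hz, fun w hw => ?_⟩
  -- At a fixed point of `x ↦ p (x - s F x)` the obtuse-angle property is the variational inequality
  -- scaled by `-s`.
  have h1 := hp (z - s • F z) w hw
  have h2 : p (z - s • F z) = z := hfix
  rw [h2, sub_sub_cancel_left, inner_neg_left, real_inner_smul_left] at h1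
  by_contra h
  push Not at h
  nlinarith

/-- The choice in `nearestPoint` is justified by existence of a minimizer in a closed convex set;
convexity then turns minimality into the obtuse-angle property, the only form used later. -/
theorem nearestPoint_spec {m : ℕ} {K : Set (EuclideanSpace ℝ (Fin m))} (hne : K.Nonempty)
    (hc : IsClosed K) (hconv : Convex ℝ K) (u : EuclideanSpace ℝ (Fin m)) :
    nearestPoint K u ∈ K ∧ ∀ w ∈ K, inner ℝ (u - nearestPoint K u) (w - nearestPoint K u) ≤ 0 := by
  have hex : ∃ z, z ∈ K ∧ ∀ w ∈ K, ‖u - z‖ ≤ ‖u - w‖ := by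
    obtain ⟨z, hz, h⟩ := exists_norm_eq_iInf_of_complete_convex hne hc.isComplete hconv u
    refine ⟨z, hz, fun w hw => ?_⟩
    rw [h]
    exact ciInf_le ⟨0, Set.forall_mem_range.2 fun _ => norm_nonneg _⟩ (⟨w, hw⟩ : K)
  obtain ⟨hmem, hmin⟩ := Classical.epsilon_spec hex
  refine ⟨hmem, (norm_eq_iInf_iff_real_inner_le_zero hconv hmem).1 ?_⟩
  have : Nonempty K := ⟨⟨_, hmem⟩⟩
  exact le_antisymm (le_ciInf fun w => hmin w w.2)
    (ciInf_le ⟨0, Set.forall_mem_range.2 fun _ => norm_nonneg _⟩ (⟨_, hmem⟩ : K))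

/-! ### The smoothed game on the shrunk set: projection, monotonicity and bias. -/

namespace Game

open MeasureTheory Metric Set Filter Topology

variable {n : ℕ} {d : Fin n → ℕ} {G : Game d} {α β r R δ : ℝ}

/-- The componentwise projection onto `(1 - δ) X`. -/
def proj (G : Game d) (δ : ℝ) (u : Profile d) : Profile d :=
  WithLp.toLp 2 fun i => nearestPoint ((1 - δ) • G.X i) (u i)

theorem Standing.isClosed_smul_X (hG : G.Standing α β r R) (δ : ℝ) (i : Fin n) :
    IsClosed ((1 - δ) • G.X i) := by
  -- Radius `δ = 1` is allowed; the set then collapses to the origin.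
  rcases eq_or_ne (1 - δ) 0 with h | h
  · rw [h, zero_smul_set ⟨0, hG.zero_mem_X i⟩]
    exact isClosed_singleton
  · exact (hG.closed_X i).smul_of_ne_zero h

theorem Standing.zero_mem_smul_X (hG : G.Standing α β r R) (δ : ℝ) (i : Fin n) :
    0 ∈ (1 - δ) • G.X i := ⟨0, hG.zero_mem_X i, smul_zero _⟩

theorem Standing.nearestPoint_spec (hG : G.Standing α β r R) (δ : ℝ) (i : Fin n)
    (u : EuclideanSpace ℝ (Fin (d i))) :
    nearestPoint ((1 - δ) • G.X i) u ∈ (1 - δ) • G.X i ∧ ∀ w ∈ (1 - δ) • G.X i,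
      inner ℝ (u - nearestPoint ((1 - δ) • G.X i) u)
        (w - nearestPoint ((1 - δ) • G.X i) u) ≤ 0 :=
  _root_.nearestPoint_spec ⟨0, hG.zero_mem_smul_X δ i⟩ (hG.isClosed_smul_X δ i)
    ((hG.convex_X i).smul _) u

theorem Standing.proj_mem (hG : G.Standing α β r R) (δ : ℝ) (u : Profile d) :
    G.proj δ u ∈ G.shrunk δ := fun i => (hG.nearestPoint_spec δ i (u i)).1

theorem Standing.inner_proj_le (hG : G.Standing α β r R) (u : Profile d) {w : Profile d}
    (hw : w ∈ G.shrunk δ) : inner ℝ (u - G.proj δ u) (w - G.proj δ u) ≤ 0 := by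
  rw [PiLp.inner_apply]
  exact Finset.sum_nonpos fun i _ => (hG.nearestPoint_spec δ i (u i)).2 (w i) (hw i)

theorem Standing.measurable_proj (hG : G.Standing α β r R) (δ : ℝ) : Measurable (G.proj δ) := by
  have : LipschitzWith 1 (G.proj δ) := LipschitzWith.of_dist_le_mul fun u w => by
    rw [NNReal.coe_one, one_mul, dist_eq_norm, dist_eq_norm]
    exact norm_sub_le_of_inner_nonpos (hG.proj_mem δ) (fun u _ hw => hG.inner_proj_le u hw) u w
  exact this.continuous.measurable

theorem Standing.isClosed_shrunk (hG : G.Standing α β r R) (δ : ℝ) : IsClosed (G.shrunk δ) := by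
  have : G.shrunk δ = ⋂ i, {x : Profile d | x i ∈ (1 - δ) • G.X i} := by ext; simp [shrunk]
  rw [this]
  exact isClosed_iInter fun i => (hG.isClosed_smul_X δ i).preimage (by fun_prop)

theorem Standing.zero_mem_shrunk (hG : G.Standing α β r R) (δ : ℝ) :
    (0 : Profile d) ∈ G.shrunk δ := fun i => hG.zero_mem_smul_X δ i

theorem Standing.norm_proj_sub_sq_le (hG : G.Standing α β r R) (u : Profile d) {z : Profile d}
    (hz : z ∈ G.shrunk δ) : ‖G.proj δ u - z‖ ^ 2 ≤ ‖u - z‖ ^ 2 := by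
  have h := hG.inner_proj_le u hz
  have h1 : u - z = (u - G.proj δ u) - (z - G.proj δ u) := by abel
  rw [norm_sub_rev (G.proj δ u), h1, norm_sub_sq_real (u - _) (z - _)]
  nlinarith [sq_nonneg ‖u - G.proj δ u‖]

/-- Averaging preserves the Lipschitz constant of each component, and `√n` collects the components.
This serves only the existence of the smoothed equilibrium; the constant enters no rate. -/
theorem Standing.norm_smoothGrad_sub_le (hG : G.Standing α β r R) (hd : ∀ i, 1 ≤ d i)
    (hδ0 : 0 ≤ δ) (hδ1 : δ ≤ 1) (hδ : G.Admissible δ) {x y : Profile d} (hx : x ∈ G.shrunk δ)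
    (hy : y ∈ G.shrunk δ) :
    ‖G.smoothGrad δ x - G.smoothGrad δ y‖ ≤ √n * (β * ‖x - y‖) := by
  refine norm_le_sqrt_of_forall_norm_le (mul_nonneg hG.beta_nonneg (norm_nonneg _)) fun i => ?_
  have := noise_isProbabilityMeasure hd i
  have h1 : (G.smoothGrad δ x - G.smoothGrad δ y) i =
      ∫ u, (G.partialGrad i (x + δ • u) - G.partialGrad i (y + δ • u)) ∂noise d i := by
    rw [integral_sub (hG.integrable_partialGrad hd hδ0 hδ1 hδ hx i i)
      (hG.integrable_partialGrad hd hδ0 hδ1 hδ hy i i)]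
    simp [smoothGrad]
  rw [h1]
  refine (norm_integral_le_of_norm_le_const (C := β * ‖x - y‖) ?_).trans (by simp)
  filter_upwards [noise_ae hd i] with u hu
  have := hG.grad_lipschitz i _ (hδ.add_mem_domain hx hu) _ (hδ.add_mem_domain hy hu)
  rwa [add_sub_add_right_eq_sub] at this

/-- The factor `n` is `√n · √n`: a perturbation has norm at most `δ √n`, and `n` components are
collected in Euclidean norm. -/
theorem Standing.norm_smoothGrad_sub_gradMap_le (hG : G.Standing α β r R) (hd : ∀ i, 1 ≤ d i)
    (hδ0 : 0 ≤ δ) (hδ1 : δ ≤ 1) (hδ : G.Admissible δ) {x : Profile d} (hx : x ∈ G.shrunk δ) :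
    ‖G.smoothGrad δ x - G.gradMap x‖ ≤ δ * (β * n) := by
  have h0 : 0 ≤ β * (δ * √n) := mul_nonneg hG.beta_nonneg (by positivity)
  have h : ‖G.smoothGrad δ x - G.gradMap x‖ ≤ √n * (β * (δ * √n)) := by
    refine norm_le_sqrt_of_forall_norm_le h0 fun i => ?_
    have := noise_isProbabilityMeasure hd i
    have h1 : (G.smoothGrad δ x - G.gradMap x) i =
        ∫ u, (G.partialGrad i (x + δ • u) - G.partialGrad i x) ∂noise d i := by
      rw [integral_sub (hG.integrable_partialGrad hd hδ0 hδ1 hδ hx i i) (integrable_const _)]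
      simp [smoothGrad, gradMap]
    rw [h1]
    refine (norm_integral_le_of_norm_le_const (C := β * (δ * √n)) ?_).trans (by simp)
    filter_upwards [noise_ae hd i] with u hu
    exact hG.norm_partialGrad_sub_le hδ0 hδ1 hδ hx hu i
  refine h.trans_eq ?_
  have := Real.mul_self_sqrt (Nat.cast_nonneg (α := ℝ) n)
  linear_combination (β * δ) * this

/-- The Lipschitz bound on second-order differences of the partial gradients. -/
theorem Standing.norm_partialGrad_second_difference_le (hG : G.Standing α β r R) {L : ℝ}
    (hL : 0 ≤ L) (hJ : G.JacobianLipschitz L) (hδ0 : 0 ≤ δ) (hδ1 : δ ≤ 1)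
    (hδ : G.Admissible δ) {x y u : Profile d} (hx : x ∈ G.shrunk δ) (hy : y ∈ G.shrunk δ)
    (hu : ∀ j, ‖u j‖ ≤ 1) (i : Fin n) :
    ‖(G.partialGrad i (x + δ • u) - G.partialGrad i (y + δ • u)) -
      (G.partialGrad i x - G.partialGrad i y)‖ ≤ L * (δ * √n) * ‖x - y‖ := by
  obtain ⟨hdiff, hlip⟩ := hJ i
  have hsub := (hG.shrunk_subset_strategies hδ0 hδ1).trans hG.strategies_subset_domain
  let ℓ : ℝ → Profile d := fun s => y + s • (x - y)
  have hℓ : ∀ s ∈ Icc (0 : ℝ) 1, ℓ s ∈ G.domain := fun s hs =>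
    hG.convex_domain.add_smul_sub_mem (hsub hy) (hsub hx) hs
  have hℓu : ∀ s ∈ Icc (0 : ℝ) 1, ℓ s + δ • u ∈ G.domain := fun s hs => by
    have h := hG.convex_domain.add_smul_sub_mem (hδ.add_mem_domain hy hu)
      (hδ.add_mem_domain hx hu) hs
    rw [add_sub_add_right_eq_sub, add_right_comm] at h
    exact h
  let J := fun z => fderivWithin ℝ (G.partialGrad i) G.domain z
  have hℓd : ∀ s, HasDerivWithinAt ℓ (x - y) (Icc 0 1) s := fun s => by
    simpa [ℓ] using (((hasDerivAt_id' s).smul_const (x - y)).const_add y).hasDerivWithinAt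
  -- Mean value inequality along the segment from `y` to `x` for the difference between the
  -- perturbed and unperturbed gradients. Its derivative compares the Jacobians at two points `δ u`
  -- apart. Both segments stay in the domain by convexity.
  have key := norm_image_sub_le_of_norm_deriv_le_segment_01'
    (f := fun s => G.partialGrad i (ℓ s + δ • u) - G.partialGrad i (ℓ s))
    (f' := fun s => J (ℓ s + δ • u) (x - y) - J (ℓ s) (x - y))
    (C := L * (δ * √n) * ‖x - y‖) ?_ ?_
  · have e1 : ℓ 1 = x := by simp [ℓ]
    have e0 : ℓ 0 = y := by simp [ℓ]
    simp only [e1, e0] at key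
    rwa [sub_sub_sub_comm] at key
  · intro s hs
    refine HasDerivWithinAt.sub ?_ ?_
    · exact ((hdiff _ (hℓu s hs)).hasFDerivWithinAt).comp_hasDerivWithinAt s
        ((hℓd s).add_const _) hℓu
    · exact ((hdiff _ (hℓ s hs)).hasFDerivWithinAt).comp_hasDerivWithinAt s (hℓd s) hℓ
  · intro s hs
    have hs' := Ico_subset_Icc_self hs
    rw [← _root_.sub_apply]
    refine (ContinuousLinearMap.le_opNorm _ _).trans ?_
    gcongr
    refine (hlip _ (hℓu s hs') _ (hℓ s hs')).trans ?_
    rw [add_sub_cancel_left, norm_smul, Real.norm_of_nonneg hδ0]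
    have := norm_le_sqrt_of_forall_norm_le zero_le_one hu
    gcongr
    linarith

/-- Smoothing with a small radius preserves half of the strong monotonicity. -/
theorem Standing.smoothGrad_monotone_of_jacobianLipschitz (hG : G.Standing α β r R)
    (hd : ∀ i, 1 ≤ d i) {L : ℝ}
    (hL : 0 ≤ L) (hJ : G.JacobianLipschitz L) (hδ0 : 0 ≤ δ) (hδ1 : δ ≤ 1)
    (hδ : G.Admissible δ) (hLδ : L * δ * n ≤ α / 2) {x y : Profile d} (hx : x ∈ G.shrunk δ)
    (hy : y ∈ G.shrunk δ) :
    α / 2 * ‖x - y‖ ^ 2 ≤ inner ℝ (G.smoothGrad δ x - G.smoothGrad δ y) (x - y) := by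
  have hsub := (hG.shrunk_subset_strategies hδ0 hδ1).trans hG.strategies_subset_domain
  have h1 : ‖(G.smoothGrad δ x - G.smoothGrad δ y) - (G.gradMap x - G.gradMap y)‖ ≤
      √n * (L * (δ * √n) * ‖x - y‖) := by
    refine norm_le_sqrt_of_forall_norm_le (by positivity) fun i => ?_
    have := noise_isProbabilityMeasure hd i
    have ix := hG.integrable_partialGrad hd hδ0 hδ1 hδ hx i i
    have iy := hG.integrable_partialGrad hd hδ0 hδ1 hδ hy i i
    have h2 : ((G.smoothGrad δ x - G.smoothGrad δ y) - (G.gradMap x - G.gradMap y)) i =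
        ∫ u, ((G.partialGrad i (x + δ • u) - G.partialGrad i (y + δ • u)) -
          (G.partialGrad i x - G.partialGrad i y)) ∂noise d i := by
      rw [integral_sub (ix.sub' iy) (integrable_const _), integral_sub ix iy]
      simp [smoothGrad, gradMap]
    rw [h2]
    refine (norm_integral_le_of_norm_le_const (C := L * (δ * √n) * ‖x - y‖) ?_).trans (by simp)
    filter_upwards [noise_ae hd i] with u hu
    exact hG.norm_partialGrad_second_difference_le hL hJ hδ0 hδ1 hδ hx hy hu i
  have h3 := hG.strongly_monotone x (hsub hx) y (hsub hy)
  have h4 := neg_le_of_abs_le (abs_real_inner_le_norm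
    ((G.smoothGrad δ x - G.smoothGrad δ y) - (G.gradMap x - G.gradMap y)) (x - y))
  -- The deviation costs at most `L δ n ≤ α/2` of the strong monotonicity constant `α`.
  have h5 : ‖(G.smoothGrad δ x - G.smoothGrad δ y) - (G.gradMap x - G.gradMap y)‖ * ‖x - y‖ ≤
      α / 2 * ‖x - y‖ ^ 2 := by
    calc _ ≤ √n * (L * (δ * √n) * ‖x - y‖) * ‖x - y‖ := by gcongr
      _ = L * δ * n * ‖x - y‖ ^ 2 := by
        have := Real.mul_self_sqrt (Nat.cast_nonneg (α := ℝ) n)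
        linear_combination (L * δ * ‖x - y‖ ^ 2) * this
      _ ≤ _ := by gcongr
  rw [inner_sub_left] at h4
  linarith

/-- With a single player, smoothing preserves strong monotonicity. -/
theorem Standing.smoothGrad_monotone_of_single {d : Fin 1 → ℕ} {G : Game d}
    (hG : G.Standing α β r R)
    (hd : ∀ i, 1 ≤ d i) (hδ0 : 0 ≤ δ) (hδ1 : δ ≤ 1)
    (hδ : G.Admissible δ) {x y : Profile d} (hx : x ∈ G.shrunk δ) (hy : y ∈ G.shrunk δ) :
    α * ‖x - y‖ ^ 2 ≤ inner ℝ (G.smoothGrad δ x - G.smoothGrad δ y) (x - y) := by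
  have := noise_isProbabilityMeasure hd 0
  have ix := hG.integrable_partialGrad hd hδ0 hδ1 hδ hx 0 0
  have iy := hG.integrable_partialGrad hd hδ0 hδ1 hδ hy 0 0
  -- A single player means a single noise law, so strong monotonicity can be averaged over
  -- translates. With several players each component is averaged over its own law and this argument
  -- is not available.
  have h1 : inner ℝ (G.smoothGrad δ x - G.smoothGrad δ y) (x - y) =
      ∫ u, inner ℝ (x 0 - y 0) (G.partialGrad 0 (x + δ • u) - G.partialGrad 0 (y + δ • u))
        ∂noise d 0 := by
    rw [integral_inner (ix.sub' iy), integral_sub ix iy, PiLp.inner_apply, Fin.sum_univ_one,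
      real_inner_comm]
    rfl
  rw [h1]
  calc α * ‖x - y‖ ^ 2 = ∫ _u, α * ‖x - y‖ ^ 2 ∂noise d 0 := by simp
    _ ≤ _ := by
      refine integral_mono_ae (integrable_const _) ((ix.sub' iy).const_inner _) ?_
      filter_upwards [noise_ae hd 0] with u hu
      have h := hG.strongly_monotone _ (hδ.add_mem_domain hx hu) _ (hδ.add_mem_domain hy hu)
      rw [add_sub_add_right_eq_sub, PiLp.inner_apply, Fin.sum_univ_one, real_inner_comm] at h
      exact h

/-- Each `xᵢ` minimizes player `i`'s cost over a convex set, so its derivative along every feasible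
segment is nonnegative; sum over the players. The one-sided gradient suffices for this. -/
theorem Standing.inner_gradMap_nash (hG : G.Standing α β r R) {xstar : Profile d}
    (hx : G.IsNash xstar) {y : Profile d} (hy : y ∈ G.strategies) :
    0 ≤ inner ℝ (G.gradMap xstar) (y - xstar) := by
  rw [PiLp.inner_apply]
  refine Finset.sum_nonneg fun i _ => ?_
  have hxD := hG.strategies_subset_domain hx.1
  have h1 := ((hG.cost_contDiff i xstar hxD).differentiableOn one_ne_zero
    (xstar i) (hxD i)).hasGradientWithinAt
  have h2 : IsMinOn (fun z => G.cost i (replace xstar i z)) (G.X i) (xstar i) := by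
    intro z hz
    simp only [mem_ofPred_eq, replace_apply_self]
    exact hx.2 i z hz
  have h3 := h2.localize.hasFDerivWithinAt_nonneg
    (h1.hasFDerivWithinAt.mono (hG.X_subset_D i)) (y := y i - xstar i)
    (sub_mem_posTangentConeAt_of_segment_subset
      ((hG.convex_X i).segment_subset (hx.1 i) (hy i)))
  rw [InnerProductSpace.toDual_apply_apply] at h3
  exact h3

/-- The bias of the smoothed game on the shrunk strategy set. -/
theorem Standing.norm_sub_nash_le (hG : G.Standing α β r R) (hd : ∀ i, 1 ≤ d i)
    (hδ0 : 0 ≤ δ) (hδ1 : δ ≤ 1) (hδ : G.Admissible δ) {xstar z : Profile d}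
    (hx : G.IsNash xstar) (hz : z ∈ G.shrunk δ)
    (hvi : ∀ w ∈ G.shrunk δ, 0 ≤ inner ℝ (G.smoothGrad δ z) (w - z)) :
    ‖z - xstar‖ ≤ δ * ((1 + β * √n / α) * R + β * n / α) := by
  have hα := hG.alpha_pos
  have hβ := hG.beta_nonneg
  have hsub := hG.shrunk_subset_strategies hδ0 hδ1
  have hxR : ‖xstar‖ ≤ R := by simpa using hG.subset_ball hx.1
  -- The equilibrium itself may lie outside the shrunk set; its scaled copy lies inside, at distance
  -- at most `δ R`, and can be tested against `z`.
  set y : Profile d := (1 - δ) • xstar with hy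
  have hyK : y ∈ G.shrunk δ := fun i => ⟨xstar i, hx.1 i, rfl⟩
  have hzD := hG.strategies_subset_domain (hsub hz)
  have hyD := hG.strategies_subset_domain (hsub hyK)
  have hxD := hG.strategies_subset_domain hx.1
  have hxy : ‖xstar - y‖ ≤ δ * R := by
    have : xstar - y = δ • xstar := by rw [hy, sub_smul, one_smul, sub_sub_cancel]
    rw [this, norm_smul, Real.norm_of_nonneg hδ0]
    gcongr
  have h1 := hvi y hyK
  -- Write `z = (1 - δ) w` with `w` a strategy profile; then `z - y = (1 - δ)(w - x⋆)` is a feasible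
  -- direction at the equilibrium.
  have h2 : 0 ≤ inner ℝ (G.gradMap xstar) (z - y) := by
    choose w hw hwz using hz
    have hzw : z = (1 - δ) • (WithLp.toLp 2 w : Profile d) := PiLp.ext fun i => (hwz i).symm
    have := hG.inner_gradMap_nash hx (y := WithLp.toLp 2 w) hw
    rw [hzw, hy, ← smul_sub, real_inner_smul_right]
    exact mul_nonneg (by linarith) this
  have h3 := hG.strongly_monotone z hzD y hyD
  have h4 := hG.norm_smoothGrad_sub_gradMap_le hd hδ0 hδ1 hδ hz
  have h5 : ‖G.gradMap xstar - G.gradMap y‖ ≤ √n * (β * (δ * R)) := by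
    have hR := hG.R_pos
    refine norm_le_sqrt_of_forall_norm_le (by positivity) fun i => ?_
    refine (hG.grad_lipschitz i _ hxD _ hyD).trans ?_
    gcongr
  have h6 := real_inner_le_norm (G.gradMap xstar - G.gradMap y) (z - y)
  have h7 := neg_le_of_abs_le (abs_real_inner_le_norm (G.smoothGrad δ z - G.gradMap z) (z - y))
  -- Add the two variational inequalities to strong monotonicity at `z, y`. What remains are the
  -- smoothing error at `z` and the change of the gradient from `x⋆` to `y`.
  have h8 : α * ‖z - y‖ ^ 2 ≤ (δ * (β * n) + √n * (β * (δ * R))) * ‖z - y‖ := by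
    have h9 : ‖G.smoothGrad δ z - G.gradMap z‖ * ‖z - y‖ ≤ δ * (β * n) * ‖z - y‖ := by gcongr
    have h10 : ‖G.gradMap xstar - G.gradMap y‖ * ‖z - y‖ ≤ √n * (β * (δ * R)) * ‖z - y‖ := by
      gcongr
    rw [← neg_sub z y, inner_neg_right] at h1
    simp only [inner_sub_left] at h3 h6 h7
    linarith
  have h11 : ‖z - y‖ ≤ (δ * (β * n) + √n * (β * (δ * R))) / α := by
    rw [le_div_iff₀ hα]
    rcases (norm_nonneg (z - y)).eq_or_lt' with h0 | h0
    · rw [h0, zero_mul]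
      have := hG.R_pos
      positivity
    · refine le_of_mul_le_mul_right ?_ h0
      linarith
  calc ‖z - xstar‖ ≤ ‖z - y‖ + ‖y - xstar‖ := norm_sub_le_norm_sub_add_norm_sub _ _ _
    _ ≤ (δ * (β * n) + √n * (β * (δ * R))) / α + δ * R := by
      rw [norm_sub_rev y]; gcongr
    _ = _ := by field_simp; ring

end Game
-- Rates from scalar recursions.
/-- The `1/t` rate for steps `2 / (α t)`. -/
theorem rate_of_recursion {e : ℕ → ℝ} {C : ℝ} (hC : 0 ≤ C)
    (h : ∀ t : ℕ, 1 ≤ t → e (t + 1) ≤ (1 - 2 / t) * e t + C / (t : ℝ) ^ 2) {t : ℕ} (ht : 3 ≤ t) :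
    e t ≤ C / t := by
  induction t, ht using Nat.le_induction with
  | base =>
    -- At `t = 2` the factor `1 - 2/t` vanishes, so `e 3 ≤ C/4` with no trace of the earlier errors.
    -- This is why `η 0` may be arbitrary.
    have := h 2 (by norm_num)
    norm_num at this ⊢
    linarith
  | succ t ht ih =>
    have ht' : (3 : ℝ) ≤ t := by exact_mod_cast ht
    have h0 : 0 ≤ 1 - 2 / (t : ℝ) := by
      rw [sub_nonneg, div_le_one (by linarith)]; linarith
    refine (h t (by omega)).trans ((add_le_add_left (mul_le_mul_of_nonneg_left ih h0) _).trans ?_)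
    push_cast
    have : C / (t + 1) - ((1 - 2 / t) * (C / t) + C / (t : ℝ) ^ 2) =
        C / ((t : ℝ) ^ 2 * (t + 1)) := by
      field_simp; ring
    have h1 : 0 ≤ C / ((t : ℝ) ^ 2 * (t + 1)) := by positivity
    linarith

/-- The `1/t` rate for steps `2 / (α (t + 1))`. -/
theorem rate_of_recursion_succ {e : ℕ → ℝ} {C : ℝ} (hC : 0 ≤ C)
    (h : ∀ t : ℕ, e (t + 1) ≤ (1 - 2 / (t + 1)) * e t + C / ((t : ℝ) + 1) ^ 2) {t : ℕ}
    (ht : 2 ≤ t) : e t ≤ C / t := by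
  induction t, ht using Nat.le_induction with
  | base =>
    -- Here the factor already vanishes at `t = 1`, giving `e 2 ≤ C/4`.
    have := h 1
    norm_num at this ⊢
    linarith
  | succ t ht ih =>
    have ht' : (2 : ℝ) ≤ t := by exact_mod_cast ht
    have h0 : 0 ≤ 1 - 2 / ((t : ℝ) + 1) := by
      rw [sub_nonneg, div_le_one (by linarith)]; linarith
    refine (h t).trans ((add_le_add_left (mul_le_mul_of_nonneg_left ih h0) _).trans ?_)
    push_cast
    have : C / (t + 1) - ((1 - 2 / ((t : ℝ) + 1)) * (C / t) + C / ((t : ℝ) + 1) ^ 2) =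
        C / (t * ((t : ℝ) + 1) ^ 2) := by
      field_simp; ring
    have h1 : 0 ≤ C / (t * ((t : ℝ) + 1) ^ 2) := by positivity
    linarith

/-! ### Progress of the iterations and accuracy of one epoch. -/

namespace Game

open MeasureTheory Metric Set Filter Topology ProbabilityTheory

variable {n : ℕ} {d : Fin n → ℕ} {G : Game d} {α β r R δ : ℝ}

/-- The bound `(d₁ + ⋯ + dₙ)² F_* / δ²` on the squared norm of the gradient estimate. -/
def estimateBound (G : Game d) (δ : ℝ) : ℝ := (((∑ i, d i : ℕ) : ℝ) / δ) ^ 2 * G.Fstar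

theorem Fstar_nonneg (G : Game d) : 0 ≤ G.Fstar :=
  Real.sSup_nonneg (by rintro s ⟨i, x, -, rfl⟩; positivity)

theorem estimateBound_nonneg (G : Game d) (δ : ℝ) : 0 ≤ G.estimateBound δ :=
  mul_nonneg (sq_nonneg _) G.Fstar_nonneg

/-- The profile of the players' gradient estimates. -/
def estimate (G : Game d) (δ : ℝ) (x : Profile d) (v : ∀ i, USphere (d i)) : Profile d :=
  WithLp.toLp 2 fun i => G.gradEst δ x v i

theorem dfoStep_eq_proj (G : Game d) (δ η : ℝ) (x : Profile d) (v : ∀ i, USphere (d i)) :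
    G.dfoStep δ η x v = G.proj δ (x - η • G.estimate δ x v) := by
  unfold dfoStep proj
  congr 1

theorem Standing.dfoStep_mem (hG : G.Standing α β r R) (δ η : ℝ) (x : Profile d)
    (v : ∀ i, USphere (d i)) : G.dfoStep δ η x v ∈ G.shrunk δ := by
  rw [dfoStep_eq_proj]
  exact hG.proj_mem δ _

theorem Standing.measurable_estimate (hG : G.Standing α β r R) (hδ : G.Admissible δ)
    {γ : Type*} [MeasurableSpace γ] {X : γ → Profile d} {V : γ → ∀ i, USphere (d i)}
    (hX : Measurable X) (hV : Measurable V) (hmem : ∀ a, X a ∈ G.shrunk δ) :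
    Measurable fun a => G.estimate δ (X a) (V a) := by
  refine measurable_toLp (f := fun i a => G.gradEst δ (X a) (V a) i) fun i => ?_
  have hc : Measurable fun a => G.cost i (query δ (X a) (V a)) :=
    hG.measurable_cost_comp i ((measurable_query δ).comp (hX.prodMk hV))
      fun a => hδ.query_mem_domain (hmem a) _
  have hVi : Measurable fun a => (V a i : EuclideanSpace ℝ (Fin (d i))) :=
    measurable_subtype_coe.comp ((measurable_pi_apply i).comp hV)
  exact (hc.const_mul _).smul hVi

theorem Standing.measurable_dfoStep (hG : G.Standing α β r R) (hδ : G.Admissible δ) (η : ℝ)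
    {γ : Type*} [MeasurableSpace γ] {X : γ → Profile d} {V : γ → ∀ i, USphere (d i)}
    (hX : Measurable X) (hV : Measurable V) (hmem : ∀ a, X a ∈ G.shrunk δ) :
    Measurable fun a => G.dfoStep δ η (X a) (V a) := by
  simp only [dfoStep_eq_proj]
  exact (hG.measurable_proj δ).comp
    (hX.sub ((hG.measurable_estimate hδ hX hV hmem).const_smul η))

theorem Standing.norm_sub_sq_le (hG : G.Standing α β r R) {x y : Profile d}
    (hx : x ∈ G.strategies) (hy : y ∈ G.strategies) : ‖x - y‖ ^ 2 ≤ 4 * R ^ 2 := by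
  have hx' : ‖x‖ ≤ R := by simpa using hG.subset_ball hx
  have hy' : ‖y‖ ≤ R := by simpa using hG.subset_ball hy
  calc ‖x - y‖ ^ 2 ≤ (2 * R) ^ 2 :=
        pow_le_pow_left₀ (norm_nonneg _) ((norm_sub_le _ _).trans (by linarith)) 2
    _ = _ := by ring

/-- The mean progress of one iteration started at a fixed point. -/
theorem Standing.integral_dfoStep_le (hG : G.Standing α β r R) (hd : ∀ i, 1 ≤ d i)
    (hδ0 : 0 < δ) (hδ1 : δ ≤ 1) (hδ : G.Admissible δ) {η : ℝ} (hη : 0 ≤ η)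
    {x z : Profile d} (hx : x ∈ G.shrunk δ) (hz : z ∈ G.shrunk δ)
    (hmono : α / 2 * ‖x - z‖ ^ 2 ≤ inner ℝ (G.smoothGrad δ x - G.smoothGrad δ z) (x - z))
    (hvi : ∀ w ∈ G.shrunk δ, 0 ≤ inner ℝ (G.smoothGrad δ z) (w - z)) :
    ∫ v, ‖G.dfoStep δ η x v - z‖ ^ 2 ∂directionLaw d ≤
      (1 - α * η) * ‖x - z‖ ^ 2 + η ^ 2 * G.estimateBound δ := by
  have hprob := directionLaw_isProbabilityMeasure hd
  let ghat : (∀ i, USphere (d i)) → Profile d := fun v => G.estimate δ x v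
  have hghat : ∀ v, ‖ghat v‖ ^ 2 ≤ G.estimateBound δ := by
    intro v
    rw [PiLp.norm_sq_eq_of_L2]
    calc ∑ i, ‖ghat v i‖ ^ 2 ≤ ∑ i, ((d i : ℝ) / δ * √G.Fstar) ^ 2 :=
          Finset.sum_le_sum fun i _ =>
            pow_le_pow_left₀ (norm_nonneg _) (hG.norm_gradEst_le hδ0 hδ hx v i) 2
      _ = (∑ i, (d i : ℝ) ^ 2) * (G.Fstar / δ ^ 2) := by
          rw [Finset.sum_mul]
          refine Finset.sum_congr rfl fun i _ => ?_
          rw [mul_pow, Real.sq_sqrt G.Fstar_nonneg]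
          ring
      _ ≤ (∑ i, (d i : ℝ)) ^ 2 * (G.Fstar / δ ^ 2) := by
          have := G.Fstar_nonneg
          gcongr
          exact Finset.sum_sq_le_sq_sum_of_nonneg fun i _ => Nat.cast_nonneg _
      _ = G.estimateBound δ := by
          rw [estimateBound]
          push_cast
          ring
  have hinner : ∀ v, inner ℝ (ghat v) (x - z) =
      ∑ i, inner ℝ (G.gradEst δ x v i) ((x - z) i) := fun v => PiLp.inner_apply _ _
  have hi := fun i => hG.integral_inner_gradEst hd hδ0 hδ1 hδ hx i ((x - z) i)
  have hint : Integrable (fun v => inner ℝ (ghat v) (x - z)) (directionLaw d) := by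
    simp only [hinner]
    exact integrable_finsetSum _ fun i _ => (hi i).2
  have hmean : ∫ v, inner ℝ (ghat v) (x - z) ∂directionLaw d =
      inner ℝ (G.smoothGrad δ x) (x - z) := by
    simp only [hinner]
    rw [integral_finsetSum _ fun i _ => (hi i).2, PiLp.inner_apply]
    exact Finset.sum_congr rfl fun i _ => (hi i).1
  -- Projection does not increase the distance to `z`; expand the square and bound the quadratic
  -- term by the almost-sure bound on the estimate.
  have hpt : ∀ v, ‖G.dfoStep δ η x v - z‖ ^ 2 ≤
      (‖x - z‖ ^ 2 + η ^ 2 * G.estimateBound δ) - 2 * η * inner ℝ (ghat v) (x - z) := by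
    intro v
    have h1 : ‖G.dfoStep δ η x v - z‖ ^ 2 ≤ ‖(x - η • ghat v) - z‖ ^ 2 := by
      rw [dfoStep_eq_proj]
      exact hG.norm_proj_sub_sq_le _ hz
    have h2 : (x - η • ghat v) - z = (x - z) - η • ghat v := by abel
    rw [h2, norm_sub_sq_real (x - z), real_inner_smul_right, norm_smul, mul_pow,
      Real.norm_of_nonneg hη, real_inner_comm] at h1
    have h3 := mul_le_mul_of_nonneg_left (hghat v) (sq_nonneg η)
    linarith
  -- The variational inequality at `z` lets strong monotonicity bound `⟪smoothGrad x, x - z⟫` alone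
  -- from below by `α/2 ‖x - z‖²`; times `2η` this is the decrease `α η`.
  have hVI := hvi x hx
  calc ∫ v, ‖G.dfoStep δ η x v - z‖ ^ 2 ∂directionLaw d
      ≤ ∫ v, ((‖x - z‖ ^ 2 + η ^ 2 * G.estimateBound δ) - 2 * η * inner ℝ (ghat v) (x - z))
          ∂directionLaw d :=
        integral_mono_of_nonneg (.of_forall fun v => sq_nonneg _)
          ((integrable_const _).sub (hint.const_mul _)) (.of_forall hpt)
    _ = (‖x - z‖ ^ 2 + η ^ 2 * G.estimateBound δ) -
          2 * η * inner ℝ (G.smoothGrad δ x) (x - z) := by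
        rw [integral_sub (integrable_const _) (hint.const_mul _), integral_const_mul, hmean]
        simp
    _ ≤ _ := by
        rw [inner_sub_left] at hmono
        have : η * (α / 2 * ‖x - z‖ ^ 2) ≤ η * inner ℝ (G.smoothGrad δ x) (x - z) :=
          mul_le_mul_of_nonneg_left (by linarith) hη
        linarith

theorem Standing.dfo_mem (hG : G.Standing α β r R) (η : ℕ → ℝ) (v : ℕ → ∀ i, USphere (d i))
    {x : Profile d} (hx : x ∈ G.shrunk δ) (t : ℕ) : G.dfo η δ v x t ∈ G.shrunk δ := by
  cases t with
  | zero => exact hx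
  | succ t => exact hG.dfoStep_mem _ _ _ _

/-- The iterates are adapted to any filtration that contains the sampled directions. -/
theorem Standing.measurable_dfo (hG : G.Standing α β r R) (hδ : G.Admissible δ) (η : ℕ → ℝ)
    {Ω : Type*} {ℱ : ℕ → MeasurableSpace Ω} (hℱ : Monotone ℱ) {V : ℕ → Ω → ∀ i, USphere (d i)}
    (hV : ∀ t, Measurable[ℱ (t + 1)] (V t)) {Y : Ω → Profile d} (hY : Measurable[ℱ 0] Y)
    (hmem : ∀ ω, Y ω ∈ G.shrunk δ) (t : ℕ) :
    Measurable[ℱ t] fun ω => G.dfo η δ (fun s => V s ω) (Y ω) t := by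
  induction t with
  | zero => exact hY
  | succ t ih =>
    exact @Standing.measurable_dfoStep n d G α β r R δ hG hδ (η t) Ω (ℱ (t + 1)) _ _
      (ih.mono (hℱ t.le_succ) le_rfl) (hV t) fun ω => hG.dfo_mem η _ (hmem ω) t

variable {Ω : Type*} [mΩ : MeasurableSpace Ω] {P : Measure Ω} [IsProbabilityMeasure P]

/-- The mean progress of one iteration started at an independent random point. -/
theorem Standing.integral_dfoStep_comp_le (hG : G.Standing α β r R) (hd : ∀ i, 1 ≤ d i)
    (hδ0 : 0 < δ) (hδ1 : δ ≤ 1) (hδ : G.Admissible δ) {η : ℝ} (hη : 0 ≤ η) {z : Profile d}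
    (hz : z ∈ G.shrunk δ)
    (hmono : ∀ x ∈ G.shrunk δ,
      α / 2 * ‖x - z‖ ^ 2 ≤ inner ℝ (G.smoothGrad δ x - G.smoothGrad δ z) (x - z))
    (hvi : ∀ w ∈ G.shrunk δ, 0 ≤ inner ℝ (G.smoothGrad δ z) (w - z))
    {X : Ω → Profile d} {V : Ω → ∀ i, USphere (d i)} (hX : Measurable X) (hV : Measurable V)
    (hmem : ∀ ω, X ω ∈ G.shrunk δ) (hind : IndepFun X V P) (hlaw : P.map V = directionLaw d) :
    ∫ ω, ‖G.dfoStep δ η (X ω) (V ω) - z‖ ^ 2 ∂P ≤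
      (1 - α * η) * ∫ ω, ‖X ω - z‖ ^ 2 ∂P + η ^ 2 * G.estimateBound δ := by
  have hprob := directionLaw_isProbabilityMeasure hd
  have hsub := hG.shrunk_subset_strategies hδ0.le hδ1
  -- Regard the iterate as a random element of the shrunk set: the update is known to be measurable
  -- only there, and Fubini over the product of the two laws needs joint measurability.
  let X' : Ω → G.shrunk δ := fun ω => ⟨X ω, hmem ω⟩
  have hX' : Measurable X' := hX.subtype_mk
  have hind' : IndepFun X' V P := by
    rw [IndepFun_iff_Indep] at hind ⊢
    refine indep_of_indep_of_le_left hind ?_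
    rintro _ ⟨s, hs, rfl⟩
    obtain ⟨u, hu, rfl⟩ := hs
    exact ⟨u, hu, rfl⟩
  let Q : G.shrunk δ × (∀ i, USphere (d i)) → ℝ := fun p => ‖G.dfoStep δ η p.1 p.2 - z‖ ^ 2
  have hQm : Measurable Q :=
    ((hG.measurable_dfoStep hδ η (measurable_subtype_coe.comp measurable_fst) measurable_snd
      fun p => p.1.2).sub_const z).norm.pow_const 2
  have hQb : ∀ p, ‖Q p‖ ≤ 4 * R ^ 2 := fun p => by
    rw [Real.norm_of_nonneg (sq_nonneg _)]
    exact hG.norm_sub_sq_le (hsub (hG.dfoStep_mem δ η _ _)) (hsub hz)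
  have hpX : IsProbabilityMeasure (P.map X') := Measure.isProbabilityMeasure_map hX'.aemeasurable
  have hmap : P.map (fun ω => (X' ω, V ω)) = (P.map X').prod (directionLaw d) := by
    rw [(indepFun_iff_map_prod_eq_prod_map_map hX'.aemeasurable hV.aemeasurable).1 hind', hlaw]
  have hQi : Integrable Q ((P.map X').prod (directionLaw d)) :=
    Integrable.of_bound hQm.aestronglyMeasurable _ (.of_forall hQb)
  let N : G.shrunk δ → ℝ := fun x => ‖(x : Profile d) - z‖ ^ 2
  have hNm : Measurable N :=
    ((measurable_subtype_coe).sub_const z).norm.pow_const 2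
  have hNi : Integrable N (P.map X') :=
    Integrable.of_bound hNm.aestronglyMeasurable (4 * R ^ 2) (.of_forall fun x => by
      rw [Real.norm_of_nonneg (sq_nonneg _)]
      exact hG.norm_sub_sq_le (hsub x.2) (hsub hz))
  have e1 : ∫ ω, Q (X' ω, V ω) ∂P = ∫ p, Q p ∂(P.map X').prod (directionLaw d) := by
    rw [← hmap, integral_map (hX'.prodMk hV).aemeasurable hQm.aestronglyMeasurable]
  have e2 : ∫ p, Q p ∂(P.map X').prod (directionLaw d) =
      ∫ x, ∫ v, Q (x, v) ∂directionLaw d ∂P.map X' := by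
    exact integral_prod Q hQi
  have e3 : ∫ x, ∫ v, Q (x, v) ∂directionLaw d ∂P.map X' ≤
      ∫ x, ((1 - α * η) * N x + η ^ 2 * G.estimateBound δ) ∂P.map X' := by
    refine integral_mono hQi.integral_prod_left ?_ ?_
    · exact ((hNi.const_mul _).add (integrable_const _))
    · intro x
      have h := hG.integral_dfoStep_le hd hδ0 hδ1 hδ hη (x := x.1) x.2 hz (hmono x.1 x.2) hvi
      simp only [Q, N]
      exact h
  have e4 : ∫ x, ((1 - α * η) * N x + η ^ 2 * G.estimateBound δ) ∂P.map X' =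
      (1 - α * η) * ∫ ω, N (X' ω) ∂P + η ^ 2 * G.estimateBound δ := by
    rw [integral_add (hNi.const_mul _) (integrable_const _), integral_const_mul,
      integral_map hX'.aemeasurable hNm.aestronglyMeasurable, integral_const, probReal_univ,
      one_smul]
  exact (e1.trans e2).trans_le (e3.trans_eq e4)

/-- The `1/t` rate of the iterates towards the equilibrium of the smoothed game. -/
theorem Standing.integral_dfo_le (hG : G.Standing α β r R) (hd : ∀ i, 1 ≤ d i)
    (hδ0 : 0 < δ) (hδ1 : δ ≤ 1) (hδ : G.Admissible δ) {η : ℕ → ℝ}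
    (hη : (∀ t : ℕ, 1 ≤ t → η t = 2 / (α * t)) ∨ (∀ t : ℕ, η t = 2 / (α * (t + 1))))
    {z : Profile d} (hz : z ∈ G.shrunk δ)
    (hmono : ∀ x ∈ G.shrunk δ,
      α / 2 * ‖x - z‖ ^ 2 ≤ inner ℝ (G.smoothGrad δ x - G.smoothGrad δ z) (x - z))
    (hvi : ∀ w ∈ G.shrunk δ, 0 ≤ inner ℝ (G.smoothGrad δ z) (w - z))
    {ℱ : ℕ → MeasurableSpace Ω} (hℱ : Monotone ℱ) (hℱ_le : ∀ t, ℱ t ≤ mΩ)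
    {V : ℕ → Ω → ∀ i, USphere (d i)} (hV : ∀ t, Measurable[ℱ (t + 1)] (V t))
    (hind : ∀ t, Indep (ℱ t) (MeasurableSpace.comap (V t) inferInstance) P)
    (hlaw : ∀ t, P.map (V t) = directionLaw d)
    {Y : Ω → Profile d} (hY : Measurable[ℱ 0] Y)
    (hmem : ∀ ω, Y ω ∈ G.shrunk δ) {t : ℕ} (ht : 3 ≤ t) :
    ∫ ω, ‖G.dfo η δ (fun s => V s ω) (Y ω) t - z‖ ^ 2 ∂P ≤
      4 * G.estimateBound δ / α ^ 2 / t := by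
  have hα := hG.alpha_pos
  let e : ℕ → ℝ := fun t => ∫ ω, ‖G.dfo η δ (fun s => V s ω) (Y ω) t - z‖ ^ 2 ∂P
  have hstep : ∀ t, 0 ≤ η t →
      e (t + 1) ≤ (1 - α * η t) * e t + η t ^ 2 * G.estimateBound δ := by
    intro t hηt
    have hXm := hG.measurable_dfo hδ η hℱ hV hY hmem t
    refine hG.integral_dfoStep_comp_le hd hδ0 hδ1 hδ hηt hz hmono hvi
      (hXm.mono (hℱ_le t) le_rfl) ((hV t).mono (hℱ_le _) le_rfl)
      (fun ω => hG.dfo_mem η _ (hmem ω) t) ?_ (hlaw t)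
    rw [IndepFun_iff_Indep]
    exact indep_of_indep_of_le_left (hind t) hXm.comap_le
  have hC : 0 ≤ 4 * G.estimateBound δ / α ^ 2 := by
    have := G.estimateBound_nonneg δ
    positivity
  -- Either step rule gives the factor `1 - 2/s` and noise `C/s²` with `C` as in `hC`, where `s = t`
  -- or `s = t + 1`.
  rcases hη with hη | hη
  · refine rate_of_recursion (e := e) hC (fun t ht => ?_) ht
    have ht0 : (0 : ℝ) < t := by exact_mod_cast ht
    refine (hstep t (by rw [hη t ht]; positivity)).trans_eq ?_
    rw [hη t ht]
    field_simp
    ring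
  · refine rate_of_recursion_succ (e := e) hC (fun t => ?_) (by omega)
    refine (hstep t (by rw [hη t]; positivity)).trans_eq ?_
    rw [hη t]
    field_simp
    ring

theorem constB_pos (n : ℕ) (hα : 0 < α) (hβ : 0 ≤ β) (hR : 0 < R) : 0 < constB n α β R := by
  unfold constB; positivity

/-- The accuracy reached by an epoch of length `epochLength`. -/
theorem Standing.integral_epoch_le (hn : 1 ≤ n) (hG : G.Standing α β r R) (hd : ∀ i, 1 ≤ d i)
    (hδ0 : 0 < δ) (hδ1 : δ ≤ 1) (hδ : G.Admissible δ)
    (hmono : ∀ x ∈ G.shrunk δ, ∀ y ∈ G.shrunk δ,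
      α / 2 * ‖x - y‖ ^ 2 ≤ inner ℝ (G.smoothGrad δ x - G.smoothGrad δ y) (x - y))
    {η : ℕ → ℝ}
    (hη : (∀ t : ℕ, 1 ≤ t → η t = 2 / (α * t)) ∨ (∀ t : ℕ, η t = 2 / (α * (t + 1))))
    {xstar : Profile d} (hxstar : G.IsNash xstar)
    {ℱ : ℕ → MeasurableSpace Ω} (hℱ : Monotone ℱ) (hℱ_le : ∀ t, ℱ t ≤ mΩ)
    {V : ℕ → Ω → ∀ i, USphere (d i)} (hV : ∀ t, Measurable[ℱ (t + 1)] (V t))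
    (hind : ∀ t, Indep (ℱ t) (MeasurableSpace.comap (V t) inferInstance) P)
    (hlaw : ∀ t, P.map (V t) = directionLaw d)
    {Y : Ω → Profile d} (hY : Measurable[ℱ 0] Y) (hmem : ∀ ω, Y ω ∈ G.shrunk δ)
    {T : ℕ} (hT : T = epochLength (G.constA α) (constB n α β R) R δ) :
    Integrable (fun ω => ‖G.dfo η δ (fun s => V s ω) (Y ω) T - xstar‖ ^ 2) P ∧
    ∫ ω, ‖G.dfo η δ (fun s => V s ω) (Y ω) T - xstar‖ ^ 2 ∂P ≤
      2 * constB n α β R * δ ^ 2 := by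
  have hα := hG.alpha_pos
  set B := constB n α β R with hB
  have hBpos : 0 < B := constB_pos n hα hG.beta_nonneg hG.R_pos
  have hsub := hG.shrunk_subset_strategies hδ0.le hδ1
  set X : Ω → Profile d := fun ω => G.dfo η δ (fun s => V s ω) (Y ω) T with hX
  have hXmem : ∀ ω, X ω ∈ G.shrunk δ := fun ω => hG.dfo_mem η _ (hmem ω) T
  have hXm : Measurable X :=
    (hG.measurable_dfo hδ η hℱ hV hY hmem T).mono (hℱ_le T) le_rfl
  have hbd : ∀ w ∈ G.strategies, ∀ ω, ‖X ω - w‖ ^ 2 ≤ 4 * R ^ 2 := fun w hw ω =>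
    hG.norm_sub_sq_le (hsub (hXmem ω)) hw
  have hXi : ∀ w ∈ G.strategies, Integrable (fun ω => ‖X ω - w‖ ^ 2) P := fun w hw =>
    Integrable.of_bound ((hXm.sub_const w).norm.pow_const 2).aestronglyMeasurable (4 * R ^ 2)
      (.of_forall fun ω => by
        rw [Real.norm_of_nonneg (sq_nonneg _)]
        exact hbd w hw ω)
  refine ⟨hXi xstar hxstar.1, ?_⟩
  have hle : max (G.constA α / (B * δ ^ 4)) (4 * R ^ 2 / (B * δ ^ 2)) ≤ T := by
    rw [hT]; exact Nat.le_ceil _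
  have hT1 : G.constA α ≤ T * (B * δ ^ 4) := by
    rw [← div_le_iff₀ (by positivity)]; exact (le_max_left _ _).trans hle
  have hT2 : 4 * R ^ 2 ≤ T * (B * δ ^ 2) := by
    rw [← div_le_iff₀ (by positivity)]; exact (le_max_right _ _).trans hle
  -- The rate is not used for `T ≤ 2`. The second term of the epoch length is there for this case:
  -- then `4 R² ≤ T B δ² ≤ 2 B δ²`, and the diameter bound suffices.
  rcases Nat.lt_or_ge T 3 with hT3 | hT3
  · have hT' : (T : ℝ) ≤ 2 := by exact_mod_cast Nat.lt_succ_iff.1 hT3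
    calc ∫ ω, ‖X ω - xstar‖ ^ 2 ∂P ≤ ∫ _ω, 4 * R ^ 2 ∂P :=
          integral_mono (hXi xstar hxstar.1) (integrable_const _) (hbd xstar hxstar.1)
      _ = 4 * R ^ 2 := by simp
      _ ≤ T * (B * δ ^ 2) := hT2
      _ ≤ 2 * (B * δ ^ 2) := by gcongr
      _ = _ := by ring
  · obtain ⟨z, hz, hvi⟩ := exists_variational_solution (hG.isClosed_shrunk δ).isComplete
      ⟨0, hG.zero_mem_shrunk δ⟩ (hG.proj_mem δ) (fun u w hw => hG.inner_proj_le u hw)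
      (F := G.smoothGrad δ) (m := α / 2) (M := √n * β) (by positivity) hmono
      fun x hx y hy => by
        rw [mul_assoc]; exact hG.norm_smoothGrad_sub_le hd hδ0.le hδ1 hδ hx hy
    have hrate : ∫ ω, ‖X ω - z‖ ^ 2 ∂P ≤ 4 * G.estimateBound δ / α ^ 2 / T :=
      hG.integral_dfo_le hd hδ0 hδ1 hδ hη hz
        (fun x hx => hmono x hx z hz) hvi hℱ hℱ_le hV hind hlaw hY hmem hT3
    -- The error budget `2 B δ²` is split evenly between twice the squared bias, by the definition
    -- of `B`, and twice the stochastic error, by the first term of the epoch length.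
    have hbias : ‖z - xstar‖ ^ 2 ≤ B / 2 * δ ^ 2 := by
      have := pow_le_pow_left₀ (norm_nonneg _)
        (hG.norm_sub_nash_le hd hδ0.le hδ1 hδ hxstar hz hvi) 2
      refine this.trans_eq ?_
      rw [hB, constB]
      ring
    have hTpos : (0 : ℝ) < T := by exact_mod_cast (by omega : 0 < T)
    have hAB : 2 * (4 * G.estimateBound δ / α ^ 2 / T) ≤ B * δ ^ 2 := by
      -- `A` has a spare factor `n ≥ 1`, since the squared block dimensions were summed into `d²`.
      have h1 : 2 * (4 * G.estimateBound δ / α ^ 2) * δ ^ 2 ≤ G.constA α := by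
        have h2 : (1 : ℝ) ≤ n := by exact_mod_cast hn
        have h3 : 2 * (4 * G.estimateBound δ / α ^ 2) * δ ^ 2 =
            8 * G.Fstar * ((∑ i, d i : ℕ) : ℝ) ^ 2 / α ^ 2 * 1 := by
          rw [estimateBound]; field_simp; ring
        have h4 : G.constA α = 8 * G.Fstar * ((∑ i, d i : ℕ) : ℝ) ^ 2 / α ^ 2 * n := by
          rw [constA]; ring
        have := G.Fstar_nonneg
        rw [h3, h4]
        gcongr
      rw [mul_div_assoc', div_le_iff₀ hTpos]
      refine le_of_mul_le_mul_right (h1.trans (hT1.trans_eq ?_)) (by positivity : 0 < δ ^ 2)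
      ring
    calc ∫ ω, ‖X ω - xstar‖ ^ 2 ∂P
        ≤ ∫ ω, (2 * ‖X ω - z‖ ^ 2 + 2 * ‖z - xstar‖ ^ 2) ∂P := by
          refine integral_mono (hXi xstar hxstar.1)
            (((hXi z (hsub hz)).const_mul 2).add (integrable_const _)) fun ω => ?_
          have h1 := norm_sub_le_norm_sub_add_norm_sub (X ω) z xstar
          have h2 := pow_le_pow_left₀ (norm_nonneg _) h1 2
          have h3 := sq_nonneg (‖X ω - z‖ - ‖z - xstar‖)
          simp only
          linarith
      _ = 2 * ∫ ω, ‖X ω - z‖ ^ 2 ∂P + 2 * ‖z - xstar‖ ^ 2 := by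
          rw [integral_add ((hXi z (hsub hz)).const_mul 2) (integrable_const _),
            integral_const_mul]
          simp
      _ ≤ 2 * B * δ ^ 2 := by linarith

end Game
-- Counting the iterations over the epochs.
theorem epochRadius_eq (δ₁ q : ℝ) (j : ℕ) : epochRadius δ₁ q j = δ₁ * q ^ j := by
  induction j with
  | zero => simp [epochRadius]
  | succ j ih => rw [epochRadius, ih, pow_succ]; ring

theorem epochRadius_pos {δ₁ q : ℝ} (hδ : 0 < δ₁) (hq : 0 < q) (j : ℕ) :
    0 < epochRadius δ₁ q j := by
  rw [epochRadius_eq]; positivity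

theorem epochRadius_le {δ₁ q : ℝ} (hδ : 0 < δ₁) (hq : 0 < q) (hq1 : q < 1) (j : ℕ) :
    epochRadius δ₁ q j ≤ δ₁ := by
  rw [epochRadius_eq]
  exact mul_le_of_le_one_right hδ.le (pow_le_one₀ hq.le hq1.le)

theorem epochAccuracy_succ (B δ₁ q : ℝ) (j : ℕ) :
    epochAccuracy B δ₁ q (j + 1) = 2 * B * epochRadius δ₁ q j ^ 2 := by
  rw [epochAccuracy, epochRadius_eq, Nat.add_sub_cancel, mul_pow, ← pow_mul, mul_comm 2 j]
  ring

theorem epochAccuracy_pos {B δ₁ q : ℝ} (hB : 0 < B) (hδ : 0 < δ₁) (hq : 0 < q) (k : ℕ) :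
    0 < epochAccuracy B δ₁ q k := by
  unfold epochAccuracy; positivity

/-- A truncated geometric sum with ratio `1/s` is at most its last term times
`s⁻¹ / (s⁻¹ - 1)`. -/
theorem geom_sum_inv_le {s : ℝ} (hs : 0 < s) (hs1 : s < 1) (j : ℕ) :
    ∑ i ∈ Finset.range (j + 1), (s ^ i)⁻¹ ≤ s⁻¹ / (s⁻¹ - 1) * (s ^ j)⁻¹ := by
  have h1 : 0 < s⁻¹ - 1 := by rw [sub_pos]; exact (one_lt_inv₀ hs).2 hs1
  simp_rw [← inv_pow]
  rw [geom_sum_eq (by linarith), div_mul_eq_mul_div, pow_succ']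
  exact div_le_div_of_nonneg_right (by linarith) h1.le

/-- Bound the maximum by the sum and the ceiling by one extra step. The extra steps number `k`,
which is one plus half the logarithm; the rest are geometric sums with ratios `q⁻⁴` and `q⁻²`,
dominated by their last terms. -/
theorem totalSteps_le {A B R δ₁ q : ℝ} (hA : 0 ≤ A) (hB : 0 < B) (hδ : 0 < δ₁) (hq : 0 < q)
    (hq1 : q < 1) {k : ℕ} (hk : 1 ≤ k) :
    (totalSteps A B R δ₁ q k : ℝ) ≤
      1 + 1 / 2 * Real.logb (1 / q) (2 * B * δ₁ ^ 2 / epochAccuracy B δ₁ q k)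
        + 4 * B * A * (q ^ 4)⁻¹ / ((q ^ 4)⁻¹ - 1) * (epochAccuracy B δ₁ q k ^ 2)⁻¹
        + 8 * R ^ 2 * (q ^ 2)⁻¹ / ((q ^ 2)⁻¹ - 1) * (epochAccuracy B δ₁ q k)⁻¹ := by
  obtain ⟨j, rfl⟩ := Nat.exists_eq_add_of_le' hk
  have hlog : Real.logb (1 / q) (2 * B * δ₁ ^ 2 / epochAccuracy B δ₁ q (j + 1)) = 2 * j := by
    have h1 : 2 * B * δ₁ ^ 2 / epochAccuracy B δ₁ q (j + 1) = (1 / q) ^ (2 * j) := by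
      rw [epochAccuracy, Nat.add_sub_cancel, one_div, inv_pow]
      field_simp
    have h2 : 1 < 1 / q := by rw [one_div]; exact (one_lt_inv₀ hq).2 hq1
    rw [h1, Real.logb_pow, Real.logb_self_eq_one h2]
    push_cast
    ring
  have hterm : ∀ i, (epochLength A B R (epochRadius δ₁ q i) : ℝ) ≤
      1 + A / (B * δ₁ ^ 4) * ((q ^ 4) ^ i)⁻¹ + 4 * R ^ 2 / (B * δ₁ ^ 2) * ((q ^ 2) ^ i)⁻¹ := by
    intro i
    have hr := epochRadius_pos hδ hq i
    have h1 : 0 ≤ A / (B * epochRadius δ₁ q i ^ 4) := by positivity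
    have h2 : 0 ≤ 4 * R ^ 2 / (B * epochRadius δ₁ q i ^ 2) := by positivity
    have h3 := Nat.ceil_lt_add_one (
      h1.trans (le_max_left _ (4 * R ^ 2 / (B * epochRadius δ₁ q i ^ 2))))
    have h4 := max_le_add_of_nonneg h1 h2
    have h5 : A / (B * epochRadius δ₁ q i ^ 4) = A / (B * δ₁ ^ 4) * ((q ^ 4) ^ i)⁻¹ := by
      rw [epochRadius_eq, mul_pow, ← pow_mul, ← pow_mul, mul_comm i]; field_simp
    have h6 : 4 * R ^ 2 / (B * epochRadius δ₁ q i ^ 2) =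
        4 * R ^ 2 / (B * δ₁ ^ 2) * ((q ^ 2) ^ i)⁻¹ := by
      rw [epochRadius_eq, mul_pow, ← pow_mul, ← pow_mul, mul_comm i]; field_simp
    rw [← h5, ← h6]
    unfold epochLength
    linarith
  have hsum : (totalSteps A B R δ₁ q (j + 1) : ℝ) ≤
      (j + 1) + A / (B * δ₁ ^ 4) * ∑ i ∈ Finset.range (j + 1), ((q ^ 4) ^ i)⁻¹
        + 4 * R ^ 2 / (B * δ₁ ^ 2) * ∑ i ∈ Finset.range (j + 1), ((q ^ 2) ^ i)⁻¹ := by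
    rw [totalSteps, Nat.cast_sum]
    refine (Finset.sum_le_sum fun i _ => hterm i).trans_eq ?_
    rw [Finset.sum_add_distrib, Finset.sum_add_distrib, Finset.mul_sum, Finset.mul_sum]
    simp
  have hg4 := geom_sum_inv_le (s := q ^ 4) (by positivity)
    (pow_lt_one₀ hq.le hq1 (by norm_num)) j
  have hg2 := geom_sum_inv_le (s := q ^ 2) (by positivity)
    (pow_lt_one₀ hq.le hq1 (by norm_num)) j
  have h4 := mul_le_mul_of_nonneg_left hg4 (by positivity : 0 ≤ A / (B * δ₁ ^ 4))
  have h2 := mul_le_mul_of_nonneg_left hg2 (by positivity : 0 ≤ 4 * R ^ 2 / (B * δ₁ ^ 2))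
  have e4 : A / (B * δ₁ ^ 4) * ((q ^ 4)⁻¹ / ((q ^ 4)⁻¹ - 1) * ((q ^ 4) ^ j)⁻¹) =
      4 * B * A * (q ^ 4)⁻¹ / ((q ^ 4)⁻¹ - 1) * (epochAccuracy B δ₁ q (j + 1) ^ 2)⁻¹ := by
    have : epochAccuracy B δ₁ q (j + 1) ^ 2 = 4 * B ^ 2 * δ₁ ^ 4 * (q ^ 4) ^ j := by
      rw [epochAccuracy, Nat.add_sub_cancel, pow_mul q, mul_pow, ← pow_mul (q ^ 2), mul_comm j,
        pow_mul (q ^ 2)]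
      ring
    rw [this, mul_div_assoc (4 * B * A)]
    generalize (q ^ 4)⁻¹ / ((q ^ 4)⁻¹ - 1) = c
    field_simp
  have e2 : 4 * R ^ 2 / (B * δ₁ ^ 2) * ((q ^ 2)⁻¹ / ((q ^ 2)⁻¹ - 1) * ((q ^ 2) ^ j)⁻¹) =
      8 * R ^ 2 * (q ^ 2)⁻¹ / ((q ^ 2)⁻¹ - 1) * (epochAccuracy B δ₁ q (j + 1))⁻¹ := by
    have : epochAccuracy B δ₁ q (j + 1) = 2 * B * δ₁ ^ 2 * (q ^ 2) ^ j := by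
      rw [epochAccuracy, Nat.add_sub_cancel, pow_mul q]
    rw [this, mul_div_assoc (8 * R ^ 2)]
    generalize (q ^ 2)⁻¹ / ((q ^ 2)⁻¹ - 1) = c
    field_simp
    ring
  rw [hlog, ← e4, ← e2]
  linarith

theorem epochAccuracy_antitone {B δ₁ q : ℝ} (hB : 0 < B) (hq : 0 < q)
    (hq1 : q < 1) : Antitone (epochAccuracy B δ₁ q) := by
  intro k l hkl
  unfold epochAccuracy
  refine mul_le_mul_of_nonneg_left (pow_le_pow_of_le_one hq.le hq1.le (by omega)) ?_
  positivity

/-- The first epoch whose accuracy reaches `ε`. -/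
theorem exists_first_epoch {B δ₁ q ε : ℝ} (hB : 0 < B) (hδ : 0 < δ₁) (hq : 0 < q)
    (hq1 : q < 1) (hε : 0 < ε) (hε1 : ε ≤ 2 * B * δ₁ ^ 2) :
    ∃ K, 1 ≤ K ∧ epochAccuracy B δ₁ q K ≤ ε ∧ q ^ 2 * ε ≤ epochAccuracy B δ₁ q K := by
  have hex : ∃ j, 2 * B * δ₁ ^ 2 * (q ^ 2) ^ j ≤ ε := by
    obtain ⟨j, hj⟩ := exists_pow_lt_of_lt_one (x := ε / (2 * B * δ₁ ^ 2)) (by positivity)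
      (pow_lt_one₀ hq.le hq1 two_ne_zero)
    refine ⟨j, ?_⟩
    rw [lt_div_iff₀ (by positivity)] at hj
    linarith
  classical
  let j := Nat.find hex
  have hj : 2 * B * δ₁ ^ 2 * (q ^ 2) ^ j ≤ ε := Nat.find_spec hex
  have hacc : epochAccuracy B δ₁ q (j + 1) = 2 * B * δ₁ ^ 2 * (q ^ 2) ^ j := by
    rw [epochAccuracy, Nat.add_sub_cancel, pow_mul]
  refine ⟨j + 1, by omega, by rwa [hacc], ?_⟩
  rw [hacc]
  have hq2 : q ^ 2 ≤ 1 := pow_le_one₀ hq.le hq1.le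
  -- For the very first epoch use `ε ≤ 2 B δ₁²`; otherwise the preceding epoch missed `ε` and the
  -- accuracy has since shrunk by just `q²`.
  rcases Nat.eq_zero_or_pos j with h0 | h0
  · rw [h0, pow_zero, mul_one]
    exact (mul_le_of_le_one_left hε.le hq2).trans hε1
  · have := Nat.find_min hex (m := j - 1) (by omega)
    push Not at this
    obtain ⟨i, hi⟩ : ∃ i, j = i + 1 := ⟨j - 1, by omega⟩
    rw [hi] at this ⊢
    rw [Nat.add_sub_cancel] at this
    calc q ^ 2 * ε ≤ q ^ 2 * (2 * B * δ₁ ^ 2 * (q ^ 2) ^ i) := by gcongr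
      _ = _ := by ring

/-- The `O(D² / ε²)` bound on the steps needed for accuracy `ε`; here `A = a D²`. -/
theorem steps_bound {A B R a D M q e ε N : ℝ} (hB : 0 < B) (ha : 0 ≤ a)
    (hA : A = a * D ^ 2) (hD : 1 ≤ D) (hq : 0 < q) (hq1 : q < 1) (he : 0 < e) (heM : e ≤ M)
    (hε : 0 < ε) (hεM : ε ≤ M) (hqe : q ^ 2 * ε ≤ e)
    (hN : N ≤ 1 + 1 / 2 * Real.logb (1 / q) (M / e)
        + 4 * B * A * (q ^ 4)⁻¹ / ((q ^ 4)⁻¹ - 1) * (e ^ 2)⁻¹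
        + 8 * R ^ 2 * (q ^ 2)⁻¹ / ((q ^ 2)⁻¹ - 1) * e⁻¹) :
    N ≤ (q ^ 4)⁻¹ * (M ^ 2 * (1 + 1 / (4 * Real.log (1 / q)))
          + 4 * B * a * ((q ^ 4)⁻¹ / ((q ^ 4)⁻¹ - 1))
          + 8 * R ^ 2 * M * ((q ^ 2)⁻¹ / ((q ^ 2)⁻¹ - 1))) * (D ^ 2 / ε ^ 2) := by
  have hM : 0 < M := he.trans_le heM
  have hq4 : 0 < (q ^ 4)⁻¹ / ((q ^ 4)⁻¹ - 1) := by
    have : 1 < (q ^ 4)⁻¹ := (one_lt_inv₀ (by positivity)).2 (pow_lt_one₀ hq.le hq1 (by norm_num))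
    exact div_pos (by positivity) (by linarith)
  have hq2 : 0 < (q ^ 2)⁻¹ / ((q ^ 2)⁻¹ - 1) := by
    have : 1 < (q ^ 2)⁻¹ := (one_lt_inv₀ (by positivity)).2 (pow_lt_one₀ hq.le hq1 (by norm_num))
    exact div_pos (by positivity) (by linarith)
  have hlogq : 0 < Real.log (1 / q) :=
    Real.log_pos (by rw [one_div]; exact (one_lt_inv₀ hq).2 hq1)
  set c4 := (q ^ 4)⁻¹ / ((q ^ 4)⁻¹ - 1)
  set c2 := (q ^ 2)⁻¹ / ((q ^ 2)⁻¹ - 1)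
  -- Every term of the step count is compared with this single quantity.
  set w := (q ^ 4)⁻¹ * (D ^ 2 / ε ^ 2) with hw
  have hD2 : 1 ≤ D ^ 2 := one_le_pow₀ hD
  have hQ4 : 1 ≤ (q ^ 4)⁻¹ := (one_le_inv₀ (by positivity)).2 (pow_le_one₀ hq.le hq1.le)
  have hQ42 : (q ^ 2)⁻¹ ≤ (q ^ 4)⁻¹ :=
    inv_anti₀ (by positivity) (pow_le_pow_of_le_one hq.le hq1.le (by norm_num))
  have he2 : (e ^ 2)⁻¹ ≤ (q ^ 4)⁻¹ * (1 / ε ^ 2) := by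
    calc (e ^ 2)⁻¹ ≤ ((q ^ 2 * ε) ^ 2)⁻¹ :=
          inv_anti₀ (by positivity) (pow_le_pow_left₀ (by positivity) hqe 2)
      _ = _ := by field_simp
  have he2w : (e ^ 2)⁻¹ ≤ w := by
    refine he2.trans ?_
    rw [hw]
    gcongr
  have t1 : 1 ≤ M ^ 2 * w := by
    have h1 : 1 ≤ M ^ 2 / ε ^ 2 := by
      rw [one_le_div (by positivity)]
      exact pow_le_pow_left₀ hε.le hεM 2
    calc (1 : ℝ) = 1 * 1 * 1 := by norm_num
      _ ≤ (q ^ 4)⁻¹ * D ^ 2 * (M ^ 2 / ε ^ 2) := by gcongr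
      _ = M ^ 2 * w := by rw [hw]; ring
  have t2 : 1 / 2 * Real.logb (1 / q) (M / e) ≤ M ^ 2 * (1 / (4 * Real.log (1 / q))) * w := by
    have hy : 0 < M / e := by positivity
    -- From `log y² ≤ y² - 1`. This half and the half before the logarithm make the `1/4` in the
    -- constant.
    have h1 : Real.log (M / e) ≤ (M / e) ^ 2 / 2 := by
      have h2 := Real.log_le_sub_one_of_pos (show 0 < (M / e) ^ 2 by positivity)
      rw [Real.log_pow] at h2
      push_cast at h2
      linarith
    rw [Real.logb]
    calc 1 / 2 * (Real.log (M / e) / Real.log (1 / q))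
        ≤ 1 / 2 * (((M / e) ^ 2 / 2) / Real.log (1 / q)) := by gcongr
      _ = M ^ 2 * (1 / (4 * Real.log (1 / q))) * (e ^ 2)⁻¹ := by field_simp; ring
      _ ≤ _ := by gcongr
  have t3 : 4 * B * A * (q ^ 4)⁻¹ / ((q ^ 4)⁻¹ - 1) * (e ^ 2)⁻¹ ≤ 4 * B * a * c4 * w := by
    calc 4 * B * A * (q ^ 4)⁻¹ / ((q ^ 4)⁻¹ - 1) * (e ^ 2)⁻¹
        = 4 * B * a * c4 * (D ^ 2 * (e ^ 2)⁻¹) := by rw [hA]; ring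
      _ ≤ 4 * B * a * c4 * (D ^ 2 * ((q ^ 4)⁻¹ * (1 / ε ^ 2))) := by gcongr
      _ = _ := by rw [hw]; ring
  have t4 : 8 * R ^ 2 * (q ^ 2)⁻¹ / ((q ^ 2)⁻¹ - 1) * e⁻¹ ≤ 8 * R ^ 2 * M * c2 * w := by
    have h1 : e⁻¹ ≤ M * w := by
      calc e⁻¹ ≤ (q ^ 2 * ε)⁻¹ := inv_anti₀ (by positivity) hqe
        _ = (q ^ 2)⁻¹ * 1 * (ε * (1 / ε ^ 2)) := by field_simp
        _ ≤ (q ^ 4)⁻¹ * D ^ 2 * (M * (1 / ε ^ 2)) := by gcongr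
        _ = M * w := by rw [hw]; ring
    calc 8 * R ^ 2 * (q ^ 2)⁻¹ / ((q ^ 2)⁻¹ - 1) * e⁻¹ = 8 * R ^ 2 * c2 * e⁻¹ := by
          simp only [c2]; ring
      _ ≤ 8 * R ^ 2 * c2 * (M * w) := by gcongr
      _ = _ := by ring
  calc N ≤ M ^ 2 * w + M ^ 2 * (1 / (4 * Real.log (1 / q))) * w + 4 * B * a * c4 * w
        + 8 * R ^ 2 * M * c2 * w := by linarith
    _ = _ := by rw [hw]; ring

/-! ### Admissible radii, nested strategy sets and the initial radius. -/

namespace Game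

open MeasureTheory Metric Set Filter Topology ProbabilityTheory

variable {n : ℕ} {d : Fin n → ℕ} {G : Game d} {α β r R : ℝ}

/-- The radii `δ ≤ δ₁` are admissible if `δ₁` satisfies the query condition. -/
theorem Standing.admissible (hG : G.Standing α β r R) (hd : ∀ i, 1 ≤ d i) {δ₁ δ : ℝ}
    (hquery : ∀ i, ∀ x ∈ G.X i, ∀ v : USphere (d i),
      (1 - δ₁) • x + δ₁ • (v : EuclideanSpace ℝ (Fin (d i))) ∈ G.D i)
    (hδ₁ : 0 < δ₁) (hδ : 0 ≤ δ) (hle : δ ≤ δ₁) : G.Admissible δ := by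
  -- The query at radius `δ` lies on the segment from `x` to the query at radius `δ₁`, at parameter
  -- `δ/δ₁`.
  have hsphere : ∀ i, ∀ x ∈ G.X i, ∀ v : EuclideanSpace ℝ (Fin (d i)), ‖v‖ = 1 →
      (1 - δ) • x + δ • v ∈ G.D i := by
    intro i x hx v hv
    have h1 := hquery i x hx ⟨v, by simpa using hv⟩
    have h2 := (hG.convex_D i).add_smul_sub_mem (hG.X_subset_D i hx) h1
      (t := δ / δ₁) ⟨by positivity, (div_le_one hδ₁).2 hle⟩
    convert h2 using 1
    have h3 : δ / δ₁ * δ₁ = δ := div_mul_cancel₀ _ hδ₁.ne'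
    simp only [smul_sub, smul_add, smul_smul, sub_smul, one_smul, h3]
    abel
  rintro i _ ⟨x, hx, rfl⟩ w hw
  change (1 - δ) • x + δ • w ∈ G.D i
  obtain ⟨v, hv, hwv⟩ : ∃ v : EuclideanSpace ℝ (Fin (d i)), ‖v‖ = 1 ∧ ‖w‖ • v = w := by
    rcases eq_or_ne w 0 with rfl | h
    · exact ⟨EuclideanSpace.single ⟨0, hd i⟩ 1, by simp, by simp⟩
    · have h0 : ‖w‖ ≠ 0 := norm_ne_zero_iff.2 h
      exact ⟨‖w‖⁻¹ • w, by rw [norm_smul, norm_inv, norm_norm, inv_mul_cancel₀ h0],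
        by rw [smul_smul, mul_inv_cancel₀ h0, one_smul]⟩
  have h1 := hsphere i x hx v hv
  have h2 := hsphere i x hx (-v) (by rwa [norm_neg])
  -- A point of the ball is this convex combination of the antipodal points `v` and `-v`.
  have h3 := hG.convex_D i h1 h2 (a := (1 + ‖w‖) / 2) (b := (1 - ‖w‖) / 2)
    (by positivity) (by linarith) (by ring)
  convert h3 using 1
  conv_lhs => rw [← hwv]
  module

/-- The shrunk strategy sets grow as the radius decreases. -/
theorem Standing.shrunk_anti (hG : G.Standing α β r R) {δ δ' : ℝ} (h : δ ≤ δ') (hδ' : δ' ≤ 1) :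
    G.shrunk δ' ⊆ G.shrunk δ := by
  intro x hx i
  obtain ⟨y, hy, hyx⟩ := hx i
  rw [← hyx]
  rcases (sub_nonneg.2 (h.trans hδ')).eq_or_lt' with h0 | h0
  · have : 1 - δ' = 0 := by linarith
    rw [h0]
    exact ⟨y, hy, by simp [this]⟩
  · refine ⟨((1 - δ') / (1 - δ)) • y, (hG.convex_X i).smul_mem_of_zero_mem (hG.zero_mem_X i) hy
      ⟨div_nonneg (by linarith) h0.le, (div_le_one h0).2 (by linarith)⟩, ?_⟩
    simp only [smul_smul, mul_div_cancel₀ _ h0.ne']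

theorem initialRadius_pos (hn : 1 ≤ n) {L : ℝ} (hα : 0 < α) (hL : 0 ≤ L) (hr : 0 < r) :
    0 < initialRadius n α L r := by
  unfold initialRadius
  split_ifs with h
  · exact hr
  · have hL' : 0 < L := lt_of_le_of_ne hL (Ne.symm h)
    have hn' : (0 : ℝ) < n := by exact_mod_cast hn
    exact lt_min hr (by positivity)

/-- Monotonicity of the smoothed map only needs `L δ n ≤ α/2`; the exponent `3/2` in the radius is
more than enough, as `n ≤ n^(3/2)`. -/
theorem mul_initialRadius_le (hn : 1 ≤ n) {L : ℝ} (hα : 0 < α) (hL : 0 ≤ L) :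
    L * initialRadius n α L r * n ≤ α / 2 := by
  unfold initialRadius
  split_ifs with h
  · rw [h, zero_mul, zero_mul]; positivity
  · have hL' : 0 < L := lt_of_le_of_ne hL (Ne.symm h)
    have hn' : (1 : ℝ) ≤ n := by exact_mod_cast hn
    have h1 : (n : ℝ) ≤ (n : ℝ) ^ (3 / 2 : ℝ) := by
      conv_lhs => rw [← Real.rpow_one (n : ℝ)]
      exact Real.rpow_le_rpow_of_exponent_le hn' (by norm_num)
    have h2 : (0 : ℝ) < (n : ℝ) ^ (3 / 2 : ℝ) := by linarith
    calc L * min r (α / (2 * L * (n : ℝ) ^ (3 / 2 : ℝ))) * n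
        ≤ L * (α / (2 * L * (n : ℝ) ^ (3 / 2 : ℝ))) * (n : ℝ) ^ (3 / 2 : ℝ) := by
          have h3 : 0 ≤ L * (α / (2 * L * (n : ℝ) ^ (3 / 2 : ℝ))) := by positivity
          refine mul_le_mul (mul_le_mul_of_nonneg_left (min_le_right _ _) hL) h1 (by positivity) h3
      _ = α / 2 := by field_simp

/-- The smoothed gradient map is `α/2`-strongly monotone for all radii up to the initial one. -/
theorem Standing.smoothGrad_monotone (hn : 1 ≤ n) (hG : G.Standing α β r R) (hd : ∀ i, 1 ≤ d i)
    {L : ℝ} (hL : 0 ≤ L) {δ₁ δ : ℝ}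
    (hδ₁ : (G.JacobianLipschitz L ∧ δ₁ = initialRadius n α L r) ∨ (n = 1 ∧ δ₁ = r))
    (hδ0 : 0 ≤ δ) (hδ1 : δ ≤ 1) (hle : δ ≤ δ₁) (hδ : G.Admissible δ) :
    ∀ x ∈ G.shrunk δ, ∀ y ∈ G.shrunk δ,
      α / 2 * ‖x - y‖ ^ 2 ≤ inner ℝ (G.smoothGrad δ x - G.smoothGrad δ y) (x - y) := by
  intro x hx y hy
  have hα := hG.alpha_pos
  rcases hδ₁ with ⟨hJ, hδ₁⟩ | ⟨rfl, -⟩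
  · refine hG.smoothGrad_monotone_of_jacobianLipschitz hd hL hJ hδ0 hδ1 hδ ?_ hx hy
    refine le_trans ?_ (mul_initialRadius_le (r := r) hn hα hL)
    rw [← hδ₁]
    gcongr
  · refine le_trans ?_ (hG.smoothGrad_monotone_of_single hd hδ0 hδ1 hδ hx hy)
    gcongr
    linarith

/-! ### Independence of each iteration's directions from the past. -/

section Adapted

variable {Ω : Type*}

/-- The information generated by the directions sampled before iteration `t` of epoch `k`. -/
@[reducible]
def past (v : ℕ → ℕ → ∀ i : Fin n, Ω → USphere (d i)) (k t : ℕ) : MeasurableSpace Ω :=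
  ⨆ p ∈ {p : ℕ × ℕ × Fin n | p.1 < k ∨ p.1 = k ∧ p.2.1 < t},
    MeasurableSpace.comap (v p.1 p.2.1 p.2.2) inferInstance

theorem past_mono (v : ℕ → ℕ → ∀ i : Fin n, Ω → USphere (d i)) {k t k' t' : ℕ}
    (h : k < k' ∨ k = k' ∧ t ≤ t') : past v k t ≤ past v k' t' := by
  refine biSup_mono fun p hp => ?_
  simp only [mem_ofPred_eq] at hp ⊢
  omega

theorem measurable_past (v : ℕ → ℕ → ∀ i : Fin n, Ω → USphere (d i)) (k t : ℕ) :
    Measurable[past v k (t + 1)] fun ω i => v k t i ω := by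
  refine @measurable_pi_lambda _ _ _ (past v k (t + 1)) _ _ fun i => ?_
  refine Measurable.mono (comap_measurable (v k t i)) ?_ le_rfl
  exact le_iSup₂_of_le (f := fun (p : ℕ × ℕ × Fin n)
    (_ : p ∈ {p : ℕ × ℕ × Fin n | p.1 < k ∨ p.1 = k ∧ p.2.1 < t + 1}) =>
    MeasurableSpace.comap (v p.1 p.2.1 p.2.2) inferInstance) (k, t, i)
    (by simp) le_rfl

/-- The outputs of the epochs are adapted and stay in the shrunk strategy sets. -/
theorem Standing.restart_adapted (hG : G.Standing α β r R) (η : ℕ → ℝ) (A B : ℝ) {δ₁ q : ℝ}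
    (hδ₁ : 0 < δ₁) (hδ₁_le : δ₁ ≤ 1) (hq : 0 < q) (hq1 : q < 1)
    (hadm : ∀ j, G.Admissible (epochRadius δ₁ q j))
    {v : ℕ → ℕ → ∀ i : Fin n, Ω → USphere (d i)} {x₀ : Profile d} (hx₀ : x₀ ∈ G.shrunk δ₁)
    (j : ℕ) :
    (∀ ω, G.restart η A B R δ₁ q (fun k t i => v k t i ω) x₀ j ∈
      G.shrunk (epochRadius δ₁ q j)) ∧
    Measurable[past v (j + 1) 0]
      fun ω => G.restart η A B R δ₁ q (fun k t i => v k t i ω) x₀ j := by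
  induction j with
  | zero => exact ⟨fun _ => hx₀, measurable_const⟩
  | succ j ih =>
    have hrad : epochRadius δ₁ q (j + 1) ≤ epochRadius δ₁ q j :=
      mul_le_of_le_one_left (epochRadius_pos hδ₁ hq j).le hq1.le
    refine ⟨fun ω => hG.shrunk_anti hrad ((epochRadius_le hδ₁ hq hq1 j).trans hδ₁_le)
      (hG.dfo_mem η _ (ih.1 ω) _), ?_⟩
    have h := hG.measurable_dfo (hadm j) η (ℱ := past v (j + 1))
      (fun s t hst => past_mono v (Or.inr ⟨rfl, hst⟩))
      (V := fun t ω i => v (j + 1) t i ω) (fun t => measurable_past v (j + 1) t) ih.2 ih.1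
      (epochLength A B R (epochRadius δ₁ q j))
    -- In the lexicographic order, every iteration of epoch `j + 1` precedes iteration `0` of epoch
    -- `j + 2`.
    exact h.mono (past_mono v (Or.inl (Nat.lt_succ_self _))) le_rfl

variable [mΩ : MeasurableSpace Ω] {P : Measure Ω}

theorem past_le {v : ℕ → ℕ → ∀ i : Fin n, Ω → USphere (d i)}
    (hv : ∀ k t i, Measurable (v k t i)) (k t : ℕ) : past v k t ≤ mΩ :=
  iSup₂_le fun p _ => (hv p.1 p.2.1 p.2.2).comap_le

/-- The past and the current directions are generated by disjoint sets of indices in the independent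
family; all players of the current iteration are taken together. -/
theorem indep_past {v : ℕ → ℕ → ∀ i : Fin n, Ω → USphere (d i)}
    (hv : ∀ k t i, Measurable (v k t i))
    (hind : iIndepFun (fun p : ℕ × ℕ × Fin n => v p.1 p.2.1 p.2.2) P) (k t : ℕ) :
    Indep (past v k t) (MeasurableSpace.comap (fun ω i => v k t i ω) inferInstance) P := by
  have h := indep_iSup_of_disjoint (fun p : ℕ × ℕ × Fin n => (hv p.1 p.2.1 p.2.2).comap_le)
    hind (S := {p : ℕ × ℕ × Fin n | p.1 < k ∨ p.1 = k ∧ p.2.1 < t})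
    (T := {p : ℕ × ℕ × Fin n | p.1 = k ∧ p.2.1 = t}) (by
      rw [Set.disjoint_left]
      intro p hp hp'
      simp only [mem_ofPred_eq] at hp hp'
      omega)
  refine indep_of_indep_of_le_right h ?_
  refine Measurable.comap_le ?_
  refine @measurable_pi_lambda _ _ _ (_) _ _ fun i => ?_
  refine Measurable.mono (comap_measurable (v k t i)) ?_ le_rfl
  exact le_iSup₂_of_le (f := fun (p : ℕ × ℕ × Fin n)
    (_ : p ∈ {p : ℕ × ℕ × Fin n | p.1 = k ∧ p.2.1 = t}) =>
    MeasurableSpace.comap (v p.1 p.2.1 p.2.2) inferInstance) (k, t, i)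
    (by simp) le_rfl

theorem map_directions [IsProbabilityMeasure P] {v : ℕ → ℕ → ∀ i : Fin n, Ω → USphere (d i)}
    (hv : ∀ k t i, Measurable (v k t i)) (hlaw : ∀ k t i, P.map (v k t i) = uniformSphere (d i))
    (hind : iIndepFun (fun p : ℕ × ℕ × Fin n => v p.1 p.2.1 p.2.2) P) (k t : ℕ) :
    P.map (fun ω i => v k t i ω) = directionLaw d := by
  have hinj : Function.Injective fun i : Fin n => (k, t, i) := fun i j h => by simpa using h
  have h1 : iIndepFun (fun i => v k t i) P := hind.precomp (g := fun i : Fin n => (k, t, i)) hinj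
  rw [(iIndepFun_iff_map_fun_eq_pi_map fun i => (hv k t i).aemeasurable).1 h1, directionLaw]
  simp only [hlaw]

end Adapted

end Game

end

/-! ### The main theorem. -/

theorem mainTheorem4 {n : ℕ} (hn : 1 ≤ n) (d : Fin n → ℕ) (hd : ∀ i, 1 ≤ d i)
    (G : Game d) (α β L r R : ℝ) (hG : G.Standing α β r R) (hL : 0 ≤ L)
    -- the initial radius; for a single player, `r` may be used without any condition on Jacobians
    (δ₁ : ℝ)
    (hδ₁ : (G.JacobianLipschitz L ∧ δ₁ = initialRadius n α L r) ∨ (n = 1 ∧ δ₁ = r))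
    -- the algorithm shrinks the strategy sets and queries the costs only where they are defined
    (hδ₁_le : δ₁ ≤ 1)
    (hquery : ∀ i, ∀ x ∈ G.X i, ∀ v : USphere (d i),
      (1 - δ₁) • x + δ₁ • (v : EuclideanSpace ℝ (Fin (d i))) ∈ G.D i)
    (q : ℝ) (hq₀ : 0 < q) (hq₁ : q < 1)
    -- the steps are `2 / (α t)`, `t ≥ 1`: either iteration `t = 0, 1, …` uses `η_t`, with `η₀`
    -- arbitrary, or it uses `η_{t+1}`
    (η : ℕ → ℝ)
    (hη : (∀ t : ℕ, 1 ≤ t → η t = 2 / (α * t)) ∨ (∀ t : ℕ, η t = 2 / (α * (t + 1))))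
    (x₀ : Profile d) (hx₀ : ∀ i, x₀ i ∈ (1 - δ₁) • G.X i)
    (xstar : Profile d) (hxstar : G.IsNash xstar)
    -- independent directions, uniform on the unit spheres
    {Ω : Type*} [MeasurableSpace Ω] (P : MeasureTheory.Measure Ω)
    [MeasureTheory.IsProbabilityMeasure P]
    (v : ℕ → ℕ → ∀ i, Ω → USphere (d i))
    (hv_meas : ∀ k t i, Measurable (v k t i))
    (hv_law : ∀ k t i, P.map (v k t i) = uniformSphere (d i))
    (hv_indep : ProbabilityTheory.iIndepFun
      (fun (p : ℕ × ℕ × Fin n) => v p.1 p.2.1 p.2.2) P)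
    (A B : ℝ) (hA : A = G.constA α) (hB : B = constB n α β R)
    (y : ℕ → Ω → Profile d)
    (hy : ∀ k ω, y k ω = G.restart η A B R δ₁ q (fun k t i => v k t i ω) x₀ k) :
    (∀ k : ℕ, 1 ≤ k →
      (MeasureTheory.Integrable (fun ω => ‖y k ω - xstar‖ ^ 2) P ∧
        ∫ ω, ‖y k ω - xstar‖ ^ 2 ∂P ≤ epochAccuracy B δ₁ q k) ∧
      (totalSteps A B R δ₁ q k : ℝ) ≤
        1 + 1 / 2 * Real.logb (1 / q) (2 * B * δ₁ ^ 2 / epochAccuracy B δ₁ q k)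
          + 4 * B * A * (q ^ 4)⁻¹ / ((q ^ 4)⁻¹ - 1) * (epochAccuracy B δ₁ q k ^ 2)⁻¹
          + 8 * R ^ 2 * (q ^ 2)⁻¹ / ((q ^ 2)⁻¹ - 1) * (epochAccuracy B δ₁ q k)⁻¹) ∧
    -- anytime `O(d² / ε²)` efficiency, with a constant not involving the dimension
    (∀ ε : ℝ, 0 < ε → ε ≤ 2 * B * δ₁ ^ 2 → ∃ K : ℕ, 1 ≤ K ∧
      (∀ k : ℕ, K ≤ k → ∫ ω, ‖y k ω - xstar‖ ^ 2 ∂P ≤ ε) ∧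
      (totalSteps A B R δ₁ q K : ℝ) ≤
        (q ^ 4)⁻¹ * ((2 * B * δ₁ ^ 2) ^ 2 * (1 + 1 / (4 * Real.log (1 / q)))
          + 32 * B * G.Fstar * n / α ^ 2 * ((q ^ 4)⁻¹ / ((q ^ 4)⁻¹ - 1))
          + 8 * R ^ 2 * (2 * B * δ₁ ^ 2) * ((q ^ 2)⁻¹ / ((q ^ 2)⁻¹ - 1)))
        * (((∑ i, d i : ℕ) : ℝ) ^ 2 / ε ^ 2)) := by
  have hα := hG.alpha_pos
  have hδpos : 0 < δ₁ := by
    rcases hδ₁ with ⟨-, h⟩ | ⟨-, h⟩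
    · rw [h]; exact Game.initialRadius_pos hn hα hL hG.r_pos
    · rw [h]; exact hG.r_pos
  have hBpos : 0 < B := hB ▸ Game.constB_pos n hα hG.beta_nonneg hG.R_pos
  have hF := G.Fstar_nonneg
  have hApos : 0 ≤ A := by rw [hA, Game.constA]; positivity
  have hrad := fun j => epochRadius_pos hδpos hq₀ j
  have hradle := fun j => epochRadius_le hδpos hq₀ hq₁ j
  have hadm : ∀ j, G.Admissible (epochRadius δ₁ q j) := fun j =>
    hG.admissible hd hquery hδpos (hrad j).le (hradle j)
  have hmean : ∀ k : ℕ, 1 ≤ k → MeasureTheory.Integrable (fun ω => ‖y k ω - xstar‖ ^ 2) P ∧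
      ∫ ω, ‖y k ω - xstar‖ ^ 2 ∂P ≤ epochAccuracy B δ₁ q k := by
    intro k hk
    -- The output `y^(j+1)` comes from one epoch with radius `epochRadius δ₁ q j`; the error of
    -- `y^j` plays no role.
    obtain ⟨j, rfl⟩ := Nat.exists_eq_add_of_le' hk
    obtain ⟨hmem, hmeas⟩ := hG.restart_adapted η A B hδpos hδ₁_le hq₀ hq₁ hadm (v := v) hx₀ j
    have h := hG.integral_epoch_le hn hd (hrad j) ((hradle j).trans hδ₁_le) (hadm j)
      (hG.smoothGrad_monotone hn hd hL hδ₁ (hrad j).le ((hradle j).trans hδ₁_le) (hradle j)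
        (hadm j)) hη hxstar (P := P) (ℱ := Game.past v (j + 1))
      (fun s t hst => Game.past_mono v (Or.inr ⟨rfl, hst⟩)) (Game.past_le hv_meas (j + 1))
      (V := fun t ω i => v (j + 1) t i ω) (fun t => Game.measurable_past v (j + 1) t)
      (fun t => Game.indep_past hv_meas hv_indep (j + 1) t)
      (fun t => Game.map_directions hv_meas hv_law hv_indep (j + 1) t) hmeas hmem rfl
    rw [← hA, ← hB] at h
    rw [epochAccuracy_succ]
    simp only [hy]
    exact h
  have hsteps := fun (k : ℕ) (hk : 1 ≤ k) =>
    totalSteps_le (R := R) hApos hBpos hδpos hq₀ hq₁ hk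
  refine ⟨fun k hk => ⟨hmean k hk, hsteps k hk⟩, fun ε hε hε1 => ?_⟩
  obtain ⟨K, hK, hKε, hεK⟩ := exists_first_epoch hBpos hδpos hq₀ hq₁ hε hε1
  have hanti := epochAccuracy_antitone (δ₁ := δ₁) hBpos hq₀ hq₁
  refine ⟨K, hK, fun k hk => (hmean k (hK.trans hk)).2.trans ((hanti hk).trans hKε), ?_⟩
  have hD : (1 : ℝ) ≤ ((∑ i, d i : ℕ) : ℝ) := by
    have h1 : d ⟨0, hn⟩ ≤ ∑ i, d i :=
      Finset.single_le_sum (fun _ _ => Nat.zero_le _) (Finset.mem_univ _)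
    exact_mod_cast (hd _).trans h1
  have hKM : epochAccuracy B δ₁ q K ≤ 2 * B * δ₁ ^ 2 := by
    refine (hanti hK).trans_eq ?_
    simp [epochAccuracy]
  -- `A = a d²` separates the dimension from the constant, and `4 B a` is the term `32 B F_* n /
  -- α²`.
  have h := steps_bound (a := 8 * G.Fstar * n / α ^ 2) hBpos (by positivity)
    (by rw [hA, Game.constA]; ring) hD hq₀ hq₁ (epochAccuracy_pos hBpos hδpos hq₀ K)
    hKM hε hε1 hεK (hsteps K hK)
  refine h.trans_eq ?_
  ring
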